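/- Let $p,q\ge 1$ be integers with $q>1$. **The estimator.** For data $X_1,\dots,X_n\in\mathbb R^{p\times q}$ with sample mean $\bar X$ put $\tilde X_i=X_i-\bar X$, $\bar S_L=\frac1{nq}\sum_i\tilde X_i\tilde X_i^\top$ and $\bar S_R=\frac1{np}\sum_i\tilde X_i^\top\tilde X_i$. When these are nonsingular let $L=\bar S_L^{-1/2}$ and $R=\bar S_R^{-1/2}$ be the symmetric positive definite inverse square roots and $Y_i=L\tilde X_iR^\top$. For $N\in\{0,1\}$ define the left FOBI matrices $$\bar B^0=\frac1{nq}\sum_i Y_iY_i^\top Y_iY_i^\top,\qquad \bar B^1=\frac1{nq}\sum_i\|Y_i\|_F^2\,Y_iY_i^\top .$$ A left MFOBI estimate with choice $N$ is a matrix $\hat\Gamma=(\hat\gamma_{kk'})=W^\top L\in\mathbb R^{p\times p}$, where $W$ is orthogonal and $W^\top\bar B^NW$ is diagonal ($N=1$ is the normed choice). **The model.** Let $Z_1,Z_2,\dots$ be i.i.d. copies of a random $p\times q$ matrix $Z=(z_{kl})$ with finite eighth moments whose entries are mutually independent with mean $0$ and variance $1$. Put $\beta_{kl}=\mathrm E(z_{kl}^4)$,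 $\bar\beta_{k\cdot}=\frac1q\sum_l\beta_{kl}$ and $\bar\beta_{\cdot l}=\frac1p\sum_k\beta_{kl}$, and assume that $\bar\beta_{1\cdot},\dots,\bar\beta_{p\cdot}$ are distinct and that $\bar\beta_{\cdot1},\dots,\bar\beta_{\cdot q}$ are distinct. The estimates are computed from $X_i=Z_i$, $i\le n$ (identity mixing), as measurable functions of the data. A sequence of them is called consistent if $\hat\Gamma\to I_p$ in probability. **Statement.** Let $k\ne k'$. (i) For each $N\in\{0,1\}$ there is a consistent sequence of left MFOBI estimates with choice $N$, and there is a number $v_N\ge0$, the asymptotic variance of $\hat\gamma_{kk'}$, such that $\sqrt n\,\hat\gamma_{kk'}$ converges in distribution to $\mathcal N(0,v_N)$ for every such sequence. If $p>2$, then $$v_1<v_0\iff\frac1{p-2}\sum_{m\ne k,k'}\bar\beta_{m\cdot}<2 ,$$ that is, the normed choice is asymptotically superior if and only if the average kurtosis of the entries of $Z$ outside rows $k$ and $k'$ is smaller than $2$. If $p=2$, then $v_1=v_0$. (ii) If $p=2$, the two choices agree in finite samples as well. For every $n$ and all matrices $Y_1,\dots,Y_n\in\mathbb R^{2\times q}$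 (in particular for data standardized with arbitrary inverse square roots $G_L\bar S_LG_L^\top=I$, $G_R\bar S_RG_R^\top=I$) the matrices $\frac1{nq}\sum_iY_iY_i^\top Y_iY_i^\top$ and $\frac1{nq}\sum_i\|Y_i\|_F^2Y_iY_i^\top$ have the same eigenvectors. For all data, a matrix is a left MFOBI estimate with $N=0$ if and only if it is one with $N=1$. -/

import Mathlib

open MeasureTheory ProbabilityTheory Filter
open scoped Matrix NNReal Topology

namespace MFOBI

variable {n p q : ℕ}

/-- The Borel (equivalently, product) σ-algebra on real matrices. -/
instance instMeasurableSpaceMatrix {p q : ℕ} : MeasurableSpace (Matrix (Fin p) (Fin q) ℝ) :=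
  inferInstanceAs (MeasurableSpace (Fin p → Fin q → ℝ))


/-! ### The estimator -/

/-- The observations after subtraction of the sample mean. -/
noncomputable def centered (X : Fin n → Matrix (Fin p) (Fin q) ℝ) :
    Fin n → Matrix (Fin p) (Fin q) ℝ :=
  fun i => X i - (n : ℝ)⁻¹ • ∑ j, X j

/-- The sample left covariance matrix, `(1/q)` times the sample mean of `X Xᵀ` (centered data). -/
noncomputable def leftCov (X : Fin n → Matrix (Fin p) (Fin q) ℝ) : Matrix (Fin p) (Fin p) ℝ :=
  ((q : ℝ)⁻¹ * (n : ℝ)⁻¹) • ∑ i, centered X i * (centered X i)ᵀ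

/-- The sample right covariance matrix, `(1/p)` times the sample mean of `Xᵀ X` (centered data). -/
noncomputable def rightCov (X : Fin n → Matrix (Fin p) (Fin q) ℝ) : Matrix (Fin q) (Fin q) ℝ :=
  ((p : ℝ)⁻¹ * (n : ℝ)⁻¹) • ∑ i, (centered X i)ᵀ * centered X i

/-- `G` is an inverse square root of `S`. -/
def IsInvSqrt (S G : Matrix (Fin p) (Fin p) ℝ) : Prop :=
  G * S * Gᵀ = 1

/-- `G` is the symmetric inverse square root `U D^{-1/2} Uᵀ` of `S = U D Uᵀ`, i.e. the unique
inverse square root that is symmetric and positive definite. -/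
def IsSymmInvSqrt (S G : Matrix (Fin p) (Fin p) ℝ) : Prop :=
  G.PosDef ∧ IsInvSqrt S G

/-- The squared Frobenius norm of a matrix. -/
def frobSq (Y : Matrix (Fin p) (Fin q) ℝ) : ℝ :=
  ∑ a, ∑ b, Y a b ^ 2

/-- The integrand of the FOBI functional: `Y Yᵀ Y Yᵀ` for the choice `N = 0`,
and `‖Y‖_F² Y Yᵀ` for the normed choice `N = 1`. -/
def fobiTerm (N : Fin 2) (Y : Matrix (Fin p) (Fin q) ℝ) : Matrix (Fin p) (Fin p) ℝ :=
  if N = 0 then Y * Yᵀ * Y * Yᵀ else frobSq Y • (Y * Yᵀ)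

/-- The sample left FOBI functional of the matrices `Y`. -/
noncomputable def leftFobi (N : Fin 2) (Y : Fin n → Matrix (Fin p) (Fin q) ℝ) :
    Matrix (Fin p) (Fin p) ℝ :=
  ((q : ℝ)⁻¹ * (n : ℝ)⁻¹) • ∑ i, fobiTerm N (Y i)

/-- The centered data, doubly standardized by `L` and `R`. -/
noncomputable def standardized (L : Matrix (Fin p) (Fin p) ℝ) (R : Matrix (Fin q) (Fin q) ℝ)
    (X : Fin n → Matrix (Fin p) (Fin q) ℝ) : Fin n → Matrix (Fin p) (Fin q) ℝ :=
  fun i => L * centered X i * Rᵀ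

/-- `Γ` is a left MFOBI estimate for the data `X`: `Γ = Wᵀ L`, where `L` is the symmetric
inverse square root of the sample left covariance matrix and the orthogonal matrix `W` has
eigenvectors of the left FOBI matrix of the doubly standardized data as its columns. -/
def IsLeftEstimate (N : Fin 2) (X : Fin n → Matrix (Fin p) (Fin q) ℝ)
    (Γ : Matrix (Fin p) (Fin p) ℝ) : Prop :=
  ∃ (L : Matrix (Fin p) (Fin p) ℝ) (R : Matrix (Fin q) (Fin q) ℝ) (W : Matrix (Fin p) (Fin p) ℝ),
    IsSymmInvSqrt (leftCov X) L ∧ IsSymmInvSqrt (rightCov X) R ∧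
    W ∈ Matrix.orthogonalGroup (Fin p) ℝ ∧
    (Wᵀ * leftFobi N (standardized L R X) * W).IsDiag ∧
    Γ = Wᵀ * L

/-- A sequence of left MFOBI estimators: for each sample size, a measurable function of the data
whose value is a left MFOBI estimate whenever the sample covariance matrices are nonsingular
(otherwise no MFOBI estimate exists and the value is irrelevant). -/
def IsLeftEstimator (N : Fin 2)
    (g : ∀ n : ℕ, (Fin n → Matrix (Fin p) (Fin q) ℝ) → Matrix (Fin p) (Fin p) ℝ) : Prop :=
  ∀ n : ℕ, Measurable (g n) ∧
    ∀ X : Fin n → Matrix (Fin p) (Fin q) ℝ,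
      (leftCov X).PosDef → (rightCov X).PosDef → IsLeftEstimate N X (g n X)

/-! ### The model and asymptotic variances -/

section Model

variable {Ω : Type*} [MeasurableSpace Ω]

/-- The kurtosis `β_{kl} = E (z_{kl}⁴)` of an entry of a standardized random matrix. -/
noncomputable def kurt (P : Measure Ω) (Z : Ω → Matrix (Fin p) (Fin q) ℝ)
    (k : Fin p) (l : Fin q) : ℝ :=
  ∫ ω, Z ω k l ^ 4 ∂P

/-- The average kurtosis of row `k`. -/
noncomputable def rowKurt (P : Measure Ω) (Z : Ω → Matrix (Fin p) (Fin q) ℝ) (k : Fin p) : ℝ :=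
  (q : ℝ)⁻¹ * ∑ l, kurt P Z k l

/-- The average kurtosis of column `l`. -/
noncomputable def colKurt (P : Measure Ω) (Z : Ω → Matrix (Fin p) (Fin q) ℝ) (l : Fin q) : ℝ :=
  (p : ℝ)⁻¹ * ∑ k, kurt P Z k l

/-- `Z 0, Z 1, …` is an i.i.d. sequence of random `p × q` matrices with finite eighth moments,
whose entries are mutually independent with zero means and unit variances, and whose row averages
and column averages of kurtoses are distinct. -/
structure IsSample (P : Measure Ω) (Z : ℕ → Ω → Matrix (Fin p) (Fin q) ℝ) : Prop where
  measurable : ∀ i, Measurable (Z i)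
  indep : iIndepFun Z P
  identDistrib : ∀ i, IdentDistrib (Z i) (Z 0) P P
  indep_entries : iIndepFun (fun (a : Fin p × Fin q) ω => Z 0 ω a.1 a.2) P
  memLp : ∀ k l, MemLp (fun ω => Z 0 ω k l) 8 P
  mean : ∀ k l, ∫ ω, Z 0 ω k l ∂P = 0
  variance : ∀ k l, variance (fun ω => Z 0 ω k l) P = 1
  rowKurt_injective : Function.Injective (rowKurt P (Z 0))
  colKurt_injective : Function.Injective (colKurt P (Z 0))

/-- The estimate obtained from the first `n` observations. -/
def estimate (g : ∀ n : ℕ, (Fin n → Matrix (Fin p) (Fin q) ℝ) → Matrix (Fin p) (Fin p) ℝ)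
    (Z : ℕ → Ω → Matrix (Fin p) (Fin q) ℝ) (n : ℕ) (ω : Ω) : Matrix (Fin p) (Fin p) ℝ :=
  g n (fun i => Z i ω)

/-- The estimates converge (entrywise) in probability to the identity matrix. -/
def IsConsistent (P : Measure Ω) (Z : ℕ → Ω → Matrix (Fin p) (Fin q) ℝ)
    (g : ∀ n : ℕ, (Fin n → Matrix (Fin p) (Fin q) ℝ) → Matrix (Fin p) (Fin p) ℝ) : Prop :=
  ∀ a b, TendstoInMeasure P (fun n ω => estimate g Z n ω a b) atTop
    (fun _ => (1 : Matrix (Fin p) (Fin p) ℝ) a b)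

/-- `v` is the asymptotic variance of the element `(k, k')` of the left MFOBI estimate with
choice `N` (identity mixing): consistent sequences of left MFOBI estimators exist, and for each of
them `√n (γ̂_{kk'} - δ_{kk'})` converges in distribution to the normal distribution `N(0, v)`. -/
def IsAsymptoticVariance (P : Measure Ω) [IsProbabilityMeasure P]
    (Z : ℕ → Ω → Matrix (Fin p) (Fin q) ℝ) (N : Fin 2) (k k' : Fin p) (v : ℝ≥0) : Prop :=
  (∃ g, IsLeftEstimator N g ∧ IsConsistent P Z g) ∧
  ∀ g, IsLeftEstimator N g → IsConsistent P Z g →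
    TendstoInDistribution
      (fun (n : ℕ) ω => √(n : ℝ) * (estimate g Z n ω k k' - (1 : Matrix (Fin p) (Fin p) ℝ) k k'))
      atTop (id : ℝ → ℝ) (fun _ => P) (gaussianReal 0 v)

end Model

/-- `v` is an eigenvector of the matrix `B`. -/
def IsEigenvector (B : Matrix (Fin p) (Fin p) ℝ) (v : Fin p → ℝ) : Prop :=
  v ≠ 0 ∧ ∃ c : ℝ, B *ᵥ v = c • v

end MFOBI

/-! Square roots are eliminated first. With S the left covariance matrix and C the FOBI matrix
before left standardization (`fobiMat`, which contains only the inverses of the two covariance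
matrices), a matrix Γ is an MFOBI estimate exactly when ΓᵀΓ = S⁻¹ and ΓCΓᵀ is diagonal
(`isLeftEstimate_iff`). Everything else concerns S and C, which are smooth functions of sample
moments.

Asymptotics. Sums, products and matrix inverses of asymptotically linear sequences are
asymptotically linear, so the entries of S and C are; S tends to the identity and C to a diagonal
matrix whose entries λ_k are the row kurtoses plus a constant depending on N, hence distinct. Row k
of Γ is a generalized eigenvector, Σ_m Γ_km (C_mk' − d S_mk') = 0 with d → λ_k. If Γ → 1, solving
for Γ_kk' gives √n Γ_kk' ≈ √n (λ_k S_kk' − C_kk') / (λ_k' − λ_k), and the central limit theorem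
applies (`tendsto_estimate_sub_normSum`). A consistent sequence exists because diagonalizers form
compact sets with closed graph: the one nearest to the identity can be selected measurably, and by
compactness it tends to the identity.

Comparison. The gap λ_k' − λ_k does not depend on N. The influence function splits into a part built
from rows k and k' only, the same for both N, and a sum over the other rows m of z_ka z_k'b times a
centered noise of row m (`score_eq`). All these terms are orthogonal by independence, so the
variances differ only through the second moments of the noises. With β_m the average kurtosis of row
m, these sum to qβ_m + q² − 2q for N = 0 and to q²β_m − q² for N = 1. The difference is q(q − 1)(2 −
β_m); summation over m gives the criterion, and for p = 2 no row m is left.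

For p = 2 the finite-sample statement is Cayley–Hamilton: A² = tr(A)A − det(A)·1 for A = YYᵀ, so the
two FOBI matrices differ by a multiple of the identity. -/

namespace MFOBI

/-! ### Convergence and boundedness in probability, expressed by a filter -/

section Probability

variable {Ω : Type*} [MeasurableSpace Ω]

/-- The filter of events (depending on `n`) whose probability tends to one. -/
def whp (P : Measure Ω) : Filter (ℕ × Ω) where
  sets := {E | Tendsto (fun n => P {ω | (n, ω) ∉ E}) atTop (𝓝 0)}
  univ_sets := by simp
  sets_of_superset := by
    intro E F hE hEF
    exact tendsto_of_tendsto_of_tendsto_of_le_of_le tendsto_const_nhds hE (fun _ => zero_le)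
      (fun n => measure_mono fun ω h h' => h (hEF h'))
  inter_sets := by
    intro E F hE hF
    have h := Tendsto.add hE hF
    rw [add_zero] at h
    refine tendsto_of_tendsto_of_tendsto_of_le_of_le tendsto_const_nhds h (fun _ => zero_le)
      (fun n => le_trans (measure_mono ?_) (measure_union_le _ _))
    intro ω hω
    by_cases h1 : (n, ω) ∈ E
    · exact Or.inr fun h2 => hω ⟨h1, h2⟩
    · exact Or.inl h1

theorem eventually_whp {P : Measure Ω} {p : ℕ × Ω → Prop} :
    (∀ᶠ x in whp P, p x) ↔ Tendsto (fun n => P {ω | ¬ p (n, ω)}) atTop (𝓝 0) := Iff.rfl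

theorem tendsto_fst_whp (P : Measure Ω) : Tendsto Prod.fst (whp P) atTop := by
  rw [tendsto_atTop]
  intro b
  rw [eventually_whp]
  refine tendsto_const_nhds.congr' ?_
  filter_upwards [eventually_ge_atTop b] with n hn
  simp [hn]

/-- Through this equivalence, continuous mappings, products and modifications on events of vanishing
probability become ordinary limit rules along `whp P`. -/
theorem tendstoInMeasure_iff_whp {P : Measure Ω} {f : ℕ → Ω → ℝ} {c : ℝ} :
    TendstoInMeasure P f atTop (fun _ => c) ↔
      Tendsto (fun x : ℕ × Ω => f x.1 x.2) (whp P) (𝓝 c) := by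
  rw [tendstoInMeasure_iff_norm, Metric.tendsto_nhds]
  refine forall₂_congr fun ε _ => ?_
  rw [eventually_whp]
  simp only [not_lt, dist_eq_norm]

/-- A sequence of random variables is bounded in probability. -/
def BddInProb (P : Measure Ω) (b : ℕ × Ω → ℝ) : Prop :=
  ∀ ε : ENNReal, 0 < ε → ∃ M : ℝ, ∀ᶠ n in atTop, P {ω | M < |b (n, ω)|} ≤ ε

/-- Slutsky's rule o_P(1)·O_P(1) = o_P(1): outside an event of probability at most ε/2 the factor b
is bounded by M, and there a product of size at least δ forces |a| ≥ δ/(|M| + 1). -/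
theorem BddInProb.tendsto_mul {P : Measure Ω} {a b : ℕ × Ω → ℝ} (hb : BddInProb P b)
    (ha : Tendsto a (whp P) (𝓝 0)) : Tendsto (fun x => a x * b x) (whp P) (𝓝 0) := by
  rw [Metric.tendsto_nhds]
  intro δ hδ
  rw [eventually_whp, ENNReal.tendsto_nhds_zero]
  intro ε hε
  have hε2 : 0 < ε / 2 := ENNReal.half_pos hε.ne'
  obtain ⟨M, hM⟩ := hb _ hε2
  have hpos : 0 < δ / (|M| + 1) := by positivity
  have h1 := (Metric.tendsto_nhds.1 ha) _ hpos
  rw [eventually_whp, ENNReal.tendsto_nhds_zero] at h1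
  filter_upwards [hM, h1 _ hε2] with n h2 h3
  calc P {ω | ¬ dist (a (n, ω) * b (n, ω)) 0 < δ}
      ≤ P ({ω | M < |b (n, ω)|} ∪ {ω | ¬ dist (a (n, ω)) 0 < δ / (|M| + 1)}) := by
        refine measure_mono fun ω hω => ?_
        by_contra hcon
        simp only [Set.mem_union, Set.mem_ofPred_eq, not_or, not_lt, not_le,
          Real.dist_eq, sub_zero] at hcon hω
        have h4 : |b (n, ω)| ≤ |M| + 1 := hcon.1.trans ((le_abs_self M).trans (by linarith))
        rw [abs_mul] at hω
        have : |a (n, ω)| * |b (n, ω)| < δ := by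
          calc |a (n, ω)| * |b (n, ω)| ≤ |a (n, ω)| * (|M| + 1) := by gcongr
            _ < δ / (|M| + 1) * (|M| + 1) := by
              have : 0 < |M| + 1 := by positivity
              exact mul_lt_mul_of_pos_right hcon.2 this
            _ = δ := by field_simp
        linarith
    _ ≤ ε / 2 + ε / 2 := (measure_union_le _ _).trans (add_le_add h2 h3)
    _ = ε := ENNReal.add_halves ε

theorem BddInProb.mono {P : Measure Ω} {a b : ℕ × Ω → ℝ} (hb : BddInProb P b)
    (h : ∀ᶠ x in whp P, |a x| ≤ |b x|) : BddInProb P a := by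
  intro ε hε
  have hε2 : 0 < ε / 2 := ENNReal.half_pos hε.ne'
  obtain ⟨M, hM⟩ := hb _ hε2
  rw [eventually_whp, ENNReal.tendsto_nhds_zero] at h
  refine ⟨M, ?_⟩
  filter_upwards [hM, h _ hε2] with n h1 h2
  refine le_trans (measure_mono ?_) ((measure_union_le _ _).trans
    ((add_le_add h1 h2).trans_eq (ENNReal.add_halves ε)))
  intro ω hω
  by_cases h3 : |a (n, ω)| ≤ |b (n, ω)|
  · exact Or.inl (lt_of_lt_of_le hω h3)
  · exact Or.inr h3

theorem BddInProb.congr {P : Measure Ω} {a b : ℕ × Ω → ℝ} (hb : BddInProb P b)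
    (h : ∀ᶠ x in whp P, a x = b x) : BddInProb P a :=
  hb.mono (h.mono fun _ hx => by rw [hx])

theorem BddInProb.add {P : Measure Ω} {a b : ℕ × Ω → ℝ} (ha : BddInProb P a)
    (hb : BddInProb P b) : BddInProb P (fun x => a x + b x) := by
  intro ε hε
  have hε2 : 0 < ε / 2 := ENNReal.half_pos hε.ne'
  obtain ⟨M, hM⟩ := ha _ hε2
  obtain ⟨M', hM'⟩ := hb _ hε2
  refine ⟨M + M', ?_⟩
  filter_upwards [hM, hM'] with n h1 h2
  refine le_trans (measure_mono ?_) ((measure_union_le _ _).trans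
    ((add_le_add h1 h2).trans_eq (ENNReal.add_halves ε)))
  intro ω hω
  by_contra hcon
  simp only [Set.mem_union, Set.mem_ofPred_eq, not_or, not_lt] at hcon hω
  have := abs_add_le (a (n, ω)) (b (n, ω))
  linarith [hcon.1, hcon.2]

theorem bddInProb_const (P : Measure Ω) (c : ℝ) : BddInProb P (fun _ => c) := by
  intro ε _
  exact ⟨|c|, by simp⟩

theorem BddInProb.of_tendsto {P : Measure Ω} {a : ℕ × Ω → ℝ} {c : ℝ}
    (ha : Tendsto a (whp P) (𝓝 c)) : BddInProb P a := by
  refine (bddInProb_const P (|c| + 1)).mono ?_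
  filter_upwards [Metric.tendsto_nhds.1 ha 1 one_pos] with x hx
  rw [Real.dist_eq] at hx
  have := abs_sub_abs_le_abs_sub (a x) c
  rw [abs_of_nonneg (by positivity : 0 ≤ |c| + 1)]
  linarith

theorem BddInProb.const_mul {P : Measure Ω} {b : ℕ × Ω → ℝ} (hb : BddInProb P b) (c : ℝ) :
    BddInProb P (fun x => c * b x) := by
  intro ε hε
  obtain ⟨M, hM⟩ := hb _ hε
  refine ⟨|c| * |M|, ?_⟩
  filter_upwards [hM] with n h1
  refine le_trans (measure_mono ?_) h1
  intro ω hω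
  by_contra hcon
  simp only [Set.mem_ofPred_eq, not_lt] at hcon hω
  rw [abs_mul] at hω
  have : |c| * |b (n, ω)| ≤ |c| * |M| :=
    mul_le_mul_of_nonneg_left (hcon.trans (le_abs_self M)) (abs_nonneg c)
  linarith

theorem BddInProb.mul_tendsto {P : Measure Ω} {a b : ℕ × Ω → ℝ} {c : ℝ} (hb : BddInProb P b)
    (ha : Tendsto a (whp P) (𝓝 c)) : BddInProb P (fun x => a x * b x) := by
  refine (hb.const_mul (|c| + 1)).mono ?_
  filter_upwards [Metric.tendsto_nhds.1 ha 1 one_pos] with x hx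
  rw [Real.dist_eq] at hx
  have := abs_sub_abs_le_abs_sub (a x) c
  rw [abs_mul, abs_mul, abs_of_nonneg (by positivity : 0 ≤ |c| + 1)]
  gcongr
  linarith

/-- Markov's inequality for b². -/
theorem BddInProb.of_integral_sq_le {P : Measure Ω} [IsFiniteMeasure P] {b : ℕ → Ω → ℝ} {v : ℝ}
    (hb : ∀ n, MemLp (b n) 2 P) (h : ∀ n, ∫ ω, b n ω ^ 2 ∂P ≤ v) :
    BddInProb P (fun x => b x.1 x.2) := by
  intro ε hε
  by_cases htop : ε = ⊤
  · exact ⟨0, by simp [htop]⟩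
  have hε' : 0 < ε.toReal := ENNReal.toReal_pos hε.ne' htop
  -- The choice makes M²·ε = |v| + 1; the absolute value and the summand 1 keep M² positive without
  -- any sign condition on v.
  set M : ℝ := √((|v| + 1) / ε.toReal) with hMdef
  have hM2 : M ^ 2 = (|v| + 1) / ε.toReal := Real.sq_sqrt (by positivity)
  have hM2' : 0 < M ^ 2 := by rw [hM2]; positivity
  have hM0 : 0 ≤ M := Real.sqrt_nonneg _
  refine ⟨M, Eventually.of_forall fun n => ?_⟩
  have h1 := mul_meas_ge_le_integral_of_nonneg (μ := P) (f := fun ω => b n ω ^ 2)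
    (Eventually.of_forall fun ω => sq_nonneg _) (hb n).integrable_sq (M ^ 2)
  have h2 : P {ω | M < |b n ω|} ≤ P {ω | M ^ 2 ≤ b n ω ^ 2} := by
    refine measure_mono fun ω hω => ?_
    simp only [Set.mem_ofPred_eq] at hω ⊢
    rw [← sq_abs (b n ω)]
    gcongr
  refine h2.trans ?_
  have h3 : (P {ω | M ^ 2 ≤ b n ω ^ 2}).toReal ≤ ε.toReal := by
    have h4 : M ^ 2 * (P {ω | M ^ 2 ≤ b n ω ^ 2}).toReal ≤ |v| + 1 :=
      h1.trans ((h n).trans ((le_abs_self v).trans (by linarith)))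
    rw [hM2] at h4
    have h5 : (|v| + 1) * (P {ω | M ^ 2 ≤ b n ω ^ 2}).toReal ≤ (|v| + 1) * ε.toReal := by
      rw [hM2]
      calc _ = ((|v| + 1) / ε.toReal * (P {ω | (|v| + 1) / ε.toReal ≤ b n ω ^ 2}).toReal)
              * ε.toReal := by field_simp
        _ ≤ (|v| + 1) * ε.toReal := by gcongr
    exact le_of_mul_le_mul_left h5 (by positivity)
  exact (ENNReal.toReal_le_toReal (measure_ne_top _ _) htop).1 h3

/-! ### Asymptotically linear sequences -/

variable {E : Type*} [MeasurableSpace E]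

/-- Independent identically distributed random elements. -/
structure IsIID (P : Measure Ω) (Z : ℕ → Ω → E) : Prop where
  measurable : ∀ i, Measurable (Z i)
  indep : iIndepFun Z P
  identDistrib : ∀ i, IdentDistrib (Z i) (Z 0) P P

/-- The normalized partial sums `n^{-1/2} ∑_{i<n} φ (Z i)`. -/
noncomputable def normSum (Z : ℕ → Ω → E) (φ : E → ℝ) (x : ℕ × Ω) : ℝ :=
  (√(x.1 : ℝ))⁻¹ * ∑ i ∈ Finset.range x.1, φ (Z i x.2)

/-- The sequence `b` is asymptotically linear at `c` with influence function `φ`. -/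
structure AsympLin (P : Measure Ω) (Z : ℕ → Ω → E) (b : ℕ × Ω → ℝ) (c : ℝ) (φ : E → ℝ) :
    Prop where
  measurable : Measurable φ
  memLp : MemLp (fun ω => φ (Z 0 ω)) 2 P
  mean : ∫ ω, φ (Z 0 ω) ∂P = 0
  tendsto : Tendsto (fun x => √(x.1 : ℝ) * (b x - c) - normSum Z φ x) (whp P) (𝓝 0)

theorem tendsto_inv_sqrt_whp (P : Measure Ω) :
    Tendsto (fun x : ℕ × Ω => (√(x.1 : ℝ))⁻¹) (whp P) (𝓝 0) :=
  (tendsto_inv_atTop_zero.comp <| Real.tendsto_sqrt_atTop.comp <|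
      tendsto_natCast_atTop_atTop).comp (tendsto_fst_whp P)

theorem eventually_pos_whp (P : Measure Ω) : ∀ᶠ x : ℕ × Ω in whp P, 0 < x.1 :=
  (tendsto_fst_whp P).eventually (eventually_gt_atTop 0)

section
variable {P : Measure Ω} {Z : ℕ → Ω → E}

theorem IsIID.memLp_normSum (hZ : IsIID P Z) {φ : E → ℝ} (hφ : Measurable φ)
    (h2 : MemLp (fun ω => φ (Z 0 ω)) 2 P) (n : ℕ) :
    MemLp (fun ω => normSum Z φ (n, ω)) 2 P := by
  have h : ∀ i ∈ Finset.range n, MemLp (fun ω => φ (Z i ω)) 2 P :=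
    fun i _ => (((hZ.identDistrib i).comp hφ).memLp_iff).2 h2
  simpa only [normSum] using (memLp_finsetSum (Finset.range n) h).const_mul (√(n : ℝ))⁻¹

/-- By independence and centering, the second moment of the normalized sum is E φ(Z₀)² for every n >
0, a bound uniform in n. -/
theorem IsIID.bddInProb_normSum [IsProbabilityMeasure P] (hZ : IsIID P Z) {φ : E → ℝ}
    (hφ : Measurable φ)
    (h2 : MemLp (fun ω => φ (Z 0 ω)) 2 P) (h0 : ∫ ω, φ (Z 0 ω) ∂P = 0) :
    BddInProb P (normSum Z φ) := by
  refine BddInProb.of_integral_sq_le (v := ∫ ω, φ (Z 0 ω) ^ 2 ∂P)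
    (b := fun n ω => normSum Z φ (n, ω)) (hZ.memLp_normSum hφ h2) fun n => ?_
  have hid : ∀ i, IdentDistrib (fun ω => φ (Z i ω)) (fun ω => φ (Z 0 ω)) P P :=
    fun i => (hZ.identDistrib i).comp hφ
  have hm : ∀ i, MemLp (fun ω => φ (Z i ω)) 2 P := fun i => (hid i).memLp_iff.2 h2
  have hmean : ∀ i, ∫ ω, φ (Z i ω) ∂P = 0 := fun i => ((hid i).integral_eq).trans h0
  have hvar : Var[∑ i ∈ Finset.range n, (fun ω => φ (Z i ω)); P]
      = n * ∫ ω, φ (Z 0 ω) ^ 2 ∂P := by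
    rw [IndepFun.variance_sum (fun i _ => hm i)]
    · have : ∀ i ∈ Finset.range n, Var[(fun ω => φ (Z i ω)); P] = ∫ ω, φ (Z 0 ω) ^ 2 ∂P := by
        intro i _
        rw [(hid i).variance_eq, variance_of_integral_eq_zero h2.aemeasurable h0]
      rw [Finset.sum_congr rfl this]
      simp
    · intro i _ j _ hij
      exact (hZ.indep.indepFun hij).comp hφ hφ
  have hsm : MemLp (∑ i ∈ Finset.range n, (fun ω => φ (Z i ω))) 2 P :=
    memLp_finsetSum' _ fun i _ => hm i
  rw [variance_of_integral_eq_zero hsm.aemeasurable] at hvar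
  · have : ∫ ω, normSum Z φ (n, ω) ^ 2 ∂P = ((√(n : ℝ))⁻¹) ^ 2 *
        ∫ ω, (∑ i ∈ Finset.range n, (fun ω => φ (Z i ω))) ω ^ 2 ∂P := by
      rw [← integral_const_mul]
      refine integral_congr_ae (Eventually.of_forall fun ω => ?_)
      simp [normSum, mul_pow]
    rw [this, hvar, inv_pow, Real.sq_sqrt (Nat.cast_nonneg n), ← mul_assoc]
    have h5 : 0 ≤ ∫ ω, φ (Z 0 ω) ^ 2 ∂P := integral_nonneg fun ω => sq_nonneg _
    -- For n = 0 the sum is empty, so the second moment is 0 and only an inequality holds.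
    rcases Nat.eq_zero_or_pos n with rfl | hn
    · simpa using h5
    · rw [inv_mul_cancel₀ (by positivity), one_mul]
  · simp only [Finset.sum_apply]
    rw [integral_finsetSum _ fun i _ => (hm i).integrable (by norm_num)]
    simp [hmean]

namespace AsympLin

variable {b b' : ℕ × Ω → ℝ} {c c' : ℝ} {φ φ' : E → ℝ}

theorem bddInProb [IsProbabilityMeasure P] (h : AsympLin P Z b c φ) (hZ : IsIID P Z) :
    BddInProb P (fun x => √(x.1 : ℝ) * (b x - c)) := by
  refine ((BddInProb.of_tendsto h.tendsto).add
    (hZ.bddInProb_normSum h.measurable h.memLp h.mean)).congr (Eventually.of_forall fun x => ?_)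
  ring

theorem tendsto_center [IsProbabilityMeasure P] (h : AsympLin P Z b c φ) (hZ : IsIID P Z) :
    Tendsto b (whp P) (𝓝 c) := by
  have h1 := ((h.bddInProb hZ).tendsto_mul (tendsto_inv_sqrt_whp P)).add_const c
  rw [zero_add] at h1
  refine h1.congr' ?_
  filter_upwards [eventually_pos_whp P] with x hx
  have : √(x.1 : ℝ) ≠ 0 := by positivity
  field_simp
  ring

theorem congr (h : AsympLin P Z b c φ) (hb : ∀ᶠ x in whp P, b' x = b x) :
    AsympLin P Z b' c φ :=
  ⟨h.measurable, h.memLp, h.mean, h.tendsto.congr' (hb.mono fun x hx => by simp only [hx])⟩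

theorem const (c : ℝ) : AsympLin P Z (fun _ => c) c (fun _ => 0) :=
  ⟨measurable_const, by simp, by simp, by simpa [normSum] using tendsto_const_nhds⟩

theorem add [IsProbabilityMeasure P] (h : AsympLin P Z b c φ) (h' : AsympLin P Z b' c' φ') :
    AsympLin P Z (fun x => b x + b' x) (c + c') (fun z => φ z + φ' z) := by
  refine ⟨h.measurable.add h'.measurable, h.memLp.add h'.memLp, ?_, ?_⟩
  · rw [integral_add (h.memLp.integrable (by norm_num)) (h'.memLp.integrable (by norm_num)),
      h.mean, h'.mean, add_zero]
  · have := h.tendsto.add h'.tendsto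
    rw [add_zero] at this
    refine this.congr fun x => ?_
    simp only [normSum, Finset.sum_add_distrib]
    ring

theorem const_mul (h : AsympLin P Z b c φ) (a : ℝ) :
    AsympLin P Z (fun x => a * b x) (a * c) (fun z => a * φ z) := by
  refine ⟨h.measurable.const_mul a, h.memLp.const_mul a, ?_, ?_⟩
  · rw [integral_const_mul, h.mean, mul_zero]
  · have := h.tendsto.const_mul a
    rw [mul_zero] at this
    refine this.congr fun x => ?_
    simp only [normSum, ← Finset.mul_sum]
    ring

theorem neg (h : AsympLin P Z b c φ) : AsympLin P Z (fun x => -b x) (-c) (fun z => -φ z) := by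
  simpa using h.const_mul (-1)

theorem sub [IsProbabilityMeasure P] (h : AsympLin P Z b c φ) (h' : AsympLin P Z b' c' φ') :
    AsympLin P Z (fun x => b x - b' x) (c - c') (fun z => φ z - φ' z) := by
  simpa [sub_eq_add_neg] using h.add h'.neg

theorem sum [IsProbabilityMeasure P] {ι : Type*} (s : Finset ι) {b : ι → ℕ × Ω → ℝ} {c : ι → ℝ}
    {φ : ι → E → ℝ}
    (h : ∀ i ∈ s, AsympLin P Z (b i) (c i) (φ i)) :
    AsympLin P Z (fun x => ∑ i ∈ s, b i x) (∑ i ∈ s, c i) (fun z => ∑ i ∈ s, φ i z) := by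
  classical
  induction s using Finset.induction_on with
  | empty => simpa using AsympLin.const (P := P) (Z := Z) 0
  | insert i s hi ih =>
    simp only [Finset.sum_insert hi]
    exact (h i (by simp)).add (ih fun j hj => h j (by simp [hj]))

/-- The product rule: bb' − cc' = c(b' − c') + c'(b − c) + (b − c)(b' − c'), and after
multiplication by √n the last term is o_P(1)·O_P(1). -/
theorem mul [IsProbabilityMeasure P] (h : AsympLin P Z b c φ) (h' : AsympLin P Z b' c' φ')
    (hZ : IsIID P Z) :
    AsympLin P Z (fun x => b x * b' x) (c * c') (fun z => c * φ' z + φ z * c') := by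
  have h3 := (h'.const_mul c).add (h.const_mul c')
  refine ⟨?_, ?_, ?_, ?_⟩
  · simpa only [mul_comm (φ _)] using h3.measurable
  · simpa only [mul_comm (φ _)] using h3.memLp
  · simpa only [mul_comm (φ _)] using h3.mean
  · have h4 : Tendsto (fun x => b x - c) (whp P) (𝓝 0) := by
      simpa using (h.tendsto_center hZ).sub_const c
    have h5 := ((h'.bddInProb hZ).tendsto_mul h4).add h3.tendsto
    rw [add_zero] at h5
    refine h5.congr fun x => ?_
    have : normSum Z (fun z => c * φ' z + φ z * c') x
        = normSum Z (fun z => c * φ' z + c' * φ z) x := by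
      simp only [mul_comm (φ _)]
    rw [this]
    ring

end AsympLin

/-- The remainder vanishes identically as soon as n > 0. -/
theorem asympLin_mean [IsProbabilityMeasure P] {f : E → ℝ} (hf : Measurable f)
    (h2 : MemLp (fun ω => f (Z 0 ω)) 2 P) :
    AsympLin P Z (fun x => (x.1 : ℝ)⁻¹ * ∑ i ∈ Finset.range x.1, f (Z i x.2))
      (∫ ω, f (Z 0 ω) ∂P) (fun z => f z - ∫ ω, f (Z 0 ω) ∂P) := by
  refine ⟨hf.sub_const _, h2.sub (memLp_const _), ?_, ?_⟩
  · rw [integral_sub (h2.integrable (by norm_num)) (integrable_const _)]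
    simp
  · refine tendsto_const_nhds.congr' ?_
    filter_upwards [eventually_pos_whp P] with x hx
    have h1 : (0 : ℝ) < x.1 := by exact_mod_cast hx
    have h3 : √(x.1 : ℝ) ≠ 0 := by positivity
    have h4 : √(x.1 : ℝ) * (x.1 : ℝ)⁻¹ = (√(x.1 : ℝ))⁻¹ := by
      nth_rewrite 2 [← Real.mul_self_sqrt h1.le]
      field_simp
    have h5 : (√(x.1 : ℝ))⁻¹ * x.1 = √(x.1 : ℝ) := by
      nth_rewrite 2 [← Real.mul_self_sqrt h1.le]
      field_simp
    simp only [normSum, Finset.sum_sub_distrib, Finset.sum_const, Finset.card_range, nsmul_eq_mul,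
      mul_sub, ← mul_assoc, h4, h5]
    ring

/-- Central limit theorem for asymptotically linear sequences. -/
theorem AsympLin.tendstoInDistribution [IsProbabilityMeasure P] {φ : E → ℝ} {b : ℕ → Ω → ℝ}
    (hZ : IsIID P Z)
    (hφ : Measurable φ) (h2 : MemLp (fun ω => φ (Z 0 ω)) 2 P) (h0 : ∫ ω, φ (Z 0 ω) ∂P = 0)
    (hb : ∀ n, AEMeasurable (b n) P)
    (h : Tendsto (fun x : ℕ × Ω => b x.1 x.2 - normSum Z φ x) (whp P) (𝓝 0)) :
    TendstoInDistribution b atTop (id : ℝ → ℝ) (fun _ => P)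
      (gaussianReal 0 (∫ ω, φ (Z 0 ω) ^ 2 ∂P).toNNReal) := by
  have hclt := tendstoInDistribution_inv_sqrt_mul_sum_sub (P := P)
    (P' := gaussianReal 0 (∫ ω, φ (Z 0 ω) ^ 2 ∂P).toNNReal) (Y := id)
    (X := fun i ω => φ (Z i ω)) (by
      rw [variance_of_integral_eq_zero h2.aemeasurable h0]
      exact ⟨aemeasurable_id, Measure.map_id⟩) h2
    (hZ.indep.comp (fun _ => φ) fun _ => hφ) (fun i => (hZ.identDistrib i).comp hφ)
  simp only [h0, mul_zero, sub_zero] at hclt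
  refine tendstoInDistribution_of_tendstoInMeasure_sub b id hclt ?_ hb
  exact tendstoInMeasure_iff_whp.2 h

end

end Probability

/-! ### Matrix inverses -/

theorem tendsto_matrix_iff {m n : ℕ} {α : Type*} {l : Filter α}
    {S : α → Matrix (Fin m) (Fin n) ℝ} {A : Matrix (Fin m) (Fin n) ℝ} :
    Tendsto S l (𝓝 A) ↔ ∀ a b, Tendsto (fun x => S x a b) l (𝓝 (A a b)) := by
  refine (tendsto_pi_nhds (f := fun x a => S x a) (g := fun a => A a)).trans ?_
  exact forall_congr' fun a => tendsto_pi_nhds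

theorem tendsto_det_one {p : ℕ} {α : Type*} {l : Filter α} {S : α → Matrix (Fin p) (Fin p) ℝ}
    (hS : Tendsto S l (𝓝 1)) : Tendsto (fun x => (S x).det) l (𝓝 1) := by
  have h : Continuous fun A : Matrix (Fin p) (Fin p) ℝ => A.det := continuous_id.matrix_det
  simpa [Function.comp_def] using (h.tendsto 1).comp hS

theorem eventually_det_ne_zero {p : ℕ} {α : Type*} {l : Filter α}
    {S : α → Matrix (Fin p) (Fin p) ℝ} (hS : Tendsto S l (𝓝 1)) : ∀ᶠ x in l, (S x).det ≠ 0 :=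
  (tendsto_det_one hS).eventually_ne one_ne_zero

theorem tendsto_inv_one {p : ℕ} {α : Type*} {l : Filter α} {S : α → Matrix (Fin p) (Fin p) ℝ}
    (hS : Tendsto S l (𝓝 1)) : Tendsto (fun x => (S x)⁻¹) l (𝓝 1) := by
  have h : Continuous fun A : Matrix (Fin p) (Fin p) ℝ => A.adjugate :=
    continuous_id.matrix_adjugate
  have h1 : Tendsto (fun x => (S x).adjugate) l (𝓝 1) := by
    simpa [Function.comp_def] using (h.tendsto 1).comp hS
  have h2 := ((tendsto_det_one hS).inv₀ one_ne_zero).smul h1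
  simpa [Matrix.inv_def, Ring.inverse_eq_inv'] using h2

/-- Since (S − 1)(S⁻¹ − 1) = 1 − S⁻¹ − (S − 1) for invertible S, the quantity √n(S⁻¹ − 1) equals
−√n(S − 1) up to a product of a bounded and a vanishing factor. -/
theorem AsympLin.inv {Ω : Type*} [MeasurableSpace Ω] {E : Type*} [MeasurableSpace E]
    {P : Measure Ω} [IsProbabilityMeasure P] {Z : ℕ → Ω → E} (hZ : IsIID P Z) {p : ℕ}
    {S : ℕ × Ω → Matrix (Fin p) (Fin p) ℝ} {σ : Fin p → Fin p → E → ℝ}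
    (hS : ∀ a b, AsympLin P Z (fun x => S x a b) ((1 : Matrix (Fin p) (Fin p) ℝ) a b) (σ a b))
    (a b : Fin p) :
    AsympLin P Z (fun x => (S x)⁻¹ a b) ((1 : Matrix (Fin p) (Fin p) ℝ) a b)
      (fun z => -σ a b z) := by
  have hlim : Tendsto S (whp P) (𝓝 1) :=
    tendsto_matrix_iff.2 fun a b => (hS a b).tendsto_center hZ
  have hinv := tendsto_matrix_iff.1 (tendsto_inv_one hlim)
  have hn := (hS a b).neg
  refine ⟨hn.measurable, hn.memLp, hn.mean, ?_⟩
  have h1 : Tendsto (fun x => ∑ c, ((S x)⁻¹ c b - (1 : Matrix (Fin p) (Fin p) ℝ) c b) *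
      (√(x.1 : ℝ) * (S x a c - (1 : Matrix (Fin p) (Fin p) ℝ) a c))) (whp P) (𝓝 0) := by
    have := tendsto_finsetSum (Finset.univ : Finset (Fin p)) (f := fun c x =>
      ((S x)⁻¹ c b - (1 : Matrix (Fin p) (Fin p) ℝ) c b) *
      (√(x.1 : ℝ) * (S x a c - (1 : Matrix (Fin p) (Fin p) ℝ) a c)))
      (fun c _ => ((hS a c).bddInProb hZ).tendsto_mul
        (by simpa using (hinv c b).sub_const ((1 : Matrix (Fin p) (Fin p) ℝ) c b)))
    simpa using this
  have h2 := (h1.add (hS a b).tendsto).neg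
  rw [add_zero, neg_zero] at h2
  refine h2.congr' ?_
  filter_upwards [eventually_det_ne_zero hlim] with x hx
  have h3 : S x * (S x)⁻¹ = 1 := Matrix.mul_nonsing_inv _ (isUnit_iff_ne_zero.2 hx)
  have h4 : (S x - 1) * ((S x)⁻¹ - 1) = 1 - (S x)⁻¹ - (S x - 1) := by
    rw [sub_mul, mul_sub, h3, one_mul, mul_one]; abel
  have h5 := congrFun (congrFun h4 a) b
  simp only [Matrix.mul_apply, Matrix.sub_apply] at h5
  have h6 : ∑ c, ((S x)⁻¹ c b - (1 : Matrix (Fin p) (Fin p) ℝ) c b) *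
      (√(x.1 : ℝ) * (S x a c - (1 : Matrix (Fin p) (Fin p) ℝ) a c))
      = √(x.1 : ℝ) * ∑ c, (S x a c - (1 : Matrix (Fin p) (Fin p) ℝ) a c) *
        ((S x)⁻¹ c b - (1 : Matrix (Fin p) (Fin p) ℝ) c b) := by
    rw [Finset.mul_sum]
    exact Finset.sum_congr rfl fun c _ => by ring
  simp only [normSum, Finset.sum_neg_distrib]
  rw [h6, h5]
  ring

/-! ### Measurable selection by successive minimization -/

section Selection

variable {α E : Type*} [MeasurableSpace α] [TopologicalSpace E]

/-- A compact nonempty valued correspondence that hits closed sets measurably. -/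
structure IsSelectable (K : α → Set E) : Prop where
  isCompact : ∀ x, IsCompact (K x)
  isClosed : ∀ x, IsClosed (K x)
  nonempty : ∀ x, (K x).Nonempty
  measurableSet : ∀ F, IsClosed F → MeasurableSet {x | (K x ∩ F).Nonempty}

/-- The minimizers of `φ` on the values of `K`. -/
def minimizers (K : α → Set E) (φ : E → ℝ) (x : α) : Set E :=
  {y | y ∈ K x ∧ ∀ y' ∈ K x, φ y ≤ φ y'}

/-- The value φ(g x) is the minimum of φ on K x, and this minimum is at most c exactly when K x hits
the closed set {φ ≤ c}. -/
theorem IsSelectable.measurable_comp {K : α → Set E} (hK : IsSelectable K) {φ : E → ℝ}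
    (hφ : Continuous φ) (g : α → E) (hg : ∀ x, g x ∈ minimizers K φ x) :
    Measurable fun x => φ (g x) := by
  refine measurable_of_Iic fun c => ?_
  have : (fun x => φ (g x)) ⁻¹' Set.Iic c = {x | (K x ∩ {y | φ y ≤ c}).Nonempty} := by
    ext x
    constructor
    · intro h
      exact ⟨g x, (hg x).1, h⟩
    · rintro ⟨y, hy, hc⟩
      exact ((hg x).2 y hy).trans hc
  rw [this]
  exact hK.measurableSet _ (isClosed_le hφ continuous_const)

/-- The minimizers hit F exactly when the minima of φ over K x ∩ F and over K x agree. This is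
tested by countably many rational levels c: whenever K x hits {φ ≤ c}, so does K x ∩ F. -/
theorem IsSelectable.isSelectable_minimizers {K : α → Set E} (hK : IsSelectable K) {φ : E → ℝ}
    (hφ : Continuous φ) : IsSelectable (minimizers K φ) := by
  have hne : ∀ x, (minimizers K φ x).Nonempty := fun x => by
    obtain ⟨y, hy, hmin⟩ := (hK.isCompact x).exists_isMinOn (hK.nonempty x) hφ.continuousOn
    exact ⟨y, hy, fun y' hy' => hmin hy'⟩
  have hcl : ∀ x, IsClosed (minimizers K φ x) := fun x => by
    obtain ⟨y, hy, hmin⟩ := hne x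
    have : minimizers K φ x = K x ∩ {z | φ z ≤ φ y} := by
      ext z
      exact ⟨fun h => ⟨h.1, h.2 y hy⟩, fun h => ⟨h.1, fun y' hy' => le_trans h.2 (hmin y' hy')⟩⟩
    rw [this]
    exact (hK.isClosed x).inter (isClosed_le hφ continuous_const)
  refine ⟨fun x => (hK.isCompact x).of_isClosed_subset (hcl x) fun y hy => hy.1, hcl, hne, ?_⟩
  intro F hF
  have : {x | (minimizers K φ x ∩ F).Nonempty}
      = (⋃ c : ℚ, {x | (K x ∩ {y | φ y ≤ c}).Nonempty} ∩
          {x | (K x ∩ (F ∩ {y | φ y ≤ c})).Nonempty}ᶜ)ᶜ := by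
    ext x
    simp only [Set.mem_compl_iff, Set.mem_iUnion, Set.mem_inter_iff, not_exists, not_and, not_not]
    constructor
    · rintro ⟨y, ⟨hy, hmin⟩, hyF⟩ c ⟨z, hz, hzc⟩
      exact ⟨y, hy, hyF, (hmin z hz).trans hzc⟩
    · intro h
      obtain ⟨y, hy, hmin⟩ := hne x
      -- A rational level above the minimum already shows that K x meets F.
      have hFne : (K x ∩ F).Nonempty := by
        obtain ⟨c, hc⟩ := exists_rat_gt (φ y)
        obtain ⟨z, hz, hzF, _⟩ := h c ⟨y, hy, hc.le⟩
        exact ⟨z, hz, hzF⟩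
      obtain ⟨z, ⟨hz, hzF⟩, hzmin⟩ :=
        ((hK.isCompact x).inter_right hF).exists_isMinOn hFne hφ.continuousOn
      refine ⟨z, ⟨hz, fun y' hy' => le_trans ?_ (hmin y' hy')⟩, hzF⟩
      by_contra hlt
      obtain ⟨c, hc1, hc2⟩ := exists_rat_btwn (not_le.1 hlt)
      obtain ⟨w, hw, hwF, hwc⟩ := h c ⟨y, hy, hc1.le⟩
      have h1 : φ z ≤ φ w := hzmin ⟨hw, hwF⟩
      have h2 : φ w ≤ c := hwc
      linarith
  rw [this]
  refine (MeasurableSet.iUnion fun c => ?_).compl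
  have hc : IsClosed {y | φ y ≤ (c : ℝ)} := isClosed_le hφ continuous_const
  exact (hK.measurableSet _ hc).inter (hK.measurableSet _ (hF.inter hc)).compl

/-- After φ has been minimized, every selection from the refined sets gives φ its minimum value,
which is measurable. Taking coordinates for the list makes an arbitrary choice measurable. -/
theorem IsSelectable.exists_refinement {K : α → Set E} (hK : IsSelectable K) (l : List (E → ℝ))
    (hl : ∀ φ ∈ l, Continuous φ) :
    ∃ K' : α → Set E, IsSelectable K' ∧ (∀ x, K' x ⊆ K x) ∧
      ∀ g : α → E, (∀ x, g x ∈ K' x) → ∀ φ ∈ l, Measurable fun x => φ (g x) := by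
  induction l generalizing K with
  | nil => exact ⟨K, hK, fun x => subset_rfl, by simp⟩
  | cons φ l ih =>
    obtain ⟨K', h1, h2, h3⟩ := ih (hK.isSelectable_minimizers (hl φ (by simp))) fun ψ hψ => hl ψ (by simp [hψ])
    refine ⟨K', h1, fun x y hy => (h2 x hy).1, fun g hg ψ hψ => ?_⟩
    rcases List.mem_cons.1 hψ with rfl | hψ
    · exact hK.measurable_comp (hl ψ (by simp)) g fun x => h2 x (hg x)
    · exact h3 g hg ψ hψ

/-- A measurable selection that minimizes a prescribed continuous function. -/
theorem IsSelectable.exists_measurable {ι : Type*} [Fintype ι] {K : α → Set E}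
    (hK : IsSelectable K) {φ : E → ℝ} (hφ : Continuous φ) {ψ : ι → E → ℝ}
    (hψ : ∀ i, Continuous (ψ i)) :
    ∃ g : α → E, (∀ x, g x ∈ minimizers K φ x) ∧ ∀ i, Measurable fun x => ψ i (g x) := by
  obtain ⟨K', h1, h2, h3⟩ := (hK.isSelectable_minimizers hφ).exists_refinement
    ((Finset.univ : Finset ι).toList.map ψ) (by simpa using hψ)
  choose g hg using h1.nonempty
  exact ⟨g, fun x => h2 x (hg x), fun i => h3 g hg _ (by simp)⟩

end Selection

variable {n p q : ℕ}

/-! ### The estimator in terms of the inverse covariance matrices -/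

theorem frobSq_eq_trace (Y : Matrix (Fin p) (Fin q) ℝ) : frobSq Y = (Y * Yᵀ).trace := by
  simp [frobSq, Matrix.trace, Matrix.mul_apply, sq]

/-- The integrand of the left FOBI functional, with the standardization expressed by the inverse
covariance matrices `Q` (left) and `R` (right). -/
def fobiCore (N : Fin 2) (Q : Matrix (Fin p) (Fin p) ℝ) (R : Matrix (Fin q) (Fin q) ℝ)
    (x : Matrix (Fin p) (Fin q) ℝ) : Matrix (Fin p) (Fin p) ℝ :=
  if N = 0 then x * R * xᵀ * Q * (x * R * xᵀ) else (x * R * xᵀ * Q).trace • (x * R * xᵀ)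

/-- Because YYᵀ = L(x RᵀR xᵀ)Lᵀ, the factors inside depend on L and R only through LᵀL and RᵀR; for
inverse square roots these are inverse covariance matrices. -/
theorem fobiTerm_conj (N : Fin 2) (L : Matrix (Fin p) (Fin p) ℝ) (R : Matrix (Fin q) (Fin q) ℝ)
    (x : Matrix (Fin p) (Fin q) ℝ) :
    fobiTerm N (L * x * Rᵀ) = L * fobiCore N (Lᵀ * L) (Rᵀ * R) x * Lᵀ := by
  unfold fobiTerm fobiCore
  split_ifs
  · simp only [Matrix.transpose_mul, Matrix.transpose_transpose, Matrix.mul_assoc]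
  · rw [frobSq_eq_trace, Matrix.mul_smul, Matrix.smul_mul]
    congr 1
    · have h : L * x * Rᵀ * (L * x * Rᵀ)ᵀ = L * (x * (Rᵀ * R) * xᵀ) * Lᵀ := by
        simp only [Matrix.transpose_mul, Matrix.transpose_transpose, Matrix.mul_assoc]
      rw [h, Matrix.trace_mul_cycle, Matrix.trace_mul_comm]
    · simp only [Matrix.transpose_mul, Matrix.transpose_transpose, Matrix.mul_assoc]

/-- The left FOBI matrix before multiplication by the inverse square root of the left
covariance matrix. -/
noncomputable def fobiMat (N : Fin 2) (X : Fin n → Matrix (Fin p) (Fin q) ℝ) :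
    Matrix (Fin p) (Fin p) ℝ :=
  ((q : ℝ)⁻¹ * (n : ℝ)⁻¹) •
    ∑ i, fobiCore N (leftCov X)⁻¹ (rightCov X)⁻¹ (centered X i)

theorem IsInvSqrt.transpose_mul_self {S G : Matrix (Fin p) (Fin p) ℝ} (h : IsInvSqrt S G) :
    Gᵀ * G = S⁻¹ := by
  refine (Matrix.inv_eq_right_inv ?_).symm
  unfold IsInvSqrt at h
  rw [Matrix.mul_assoc, mul_eq_one_comm] at h
  rw [← Matrix.mul_assoc, h]

theorem leftFobi_standardized (N : Fin 2) {X : Fin n → Matrix (Fin p) (Fin q) ℝ}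
    {L : Matrix (Fin p) (Fin p) ℝ} {R : Matrix (Fin q) (Fin q) ℝ}
    (hL : IsInvSqrt (leftCov X) L) (hR : IsInvSqrt (rightCov X) R) :
    leftFobi N (standardized L R X) = L * fobiMat N X * Lᵀ := by
  simp only [leftFobi, fobiMat, standardized, fobiTerm_conj, hL.transpose_mul_self,
    hR.transpose_mul_self]
  rw [Matrix.mul_smul, Matrix.smul_mul, Matrix.mul_sum, Matrix.sum_mul]

/-! ### Estimates as diagonalizers by congruence -/

/-- The matrices `Γ` that satisfy `Γᵀ Γ = Q` and diagonalize `C` by congruence. -/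
def diagonalizers (Q C : Matrix (Fin p) (Fin p) ℝ) : Set (Matrix (Fin p) (Fin p) ℝ) :=
  {Γ | Γᵀ * Γ = Q ∧ (Γ * C * Γᵀ).IsDiag}

theorem IsLeftEstimate.mem_diagonalizers {N : Fin 2} {X : Fin n → Matrix (Fin p) (Fin q) ℝ}
    {Γ : Matrix (Fin p) (Fin p) ℝ} (h : IsLeftEstimate N X Γ) :
    Γ ∈ diagonalizers (leftCov X)⁻¹ (fobiMat N X) := by
  obtain ⟨L, R, W, hL, hR, hW, hd, rfl⟩ := h
  rw [leftFobi_standardized N hL.2 hR.2] at hd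
  refine ⟨?_, ?_⟩
  · rw [← hL.2.transpose_mul_self, Matrix.transpose_mul, Matrix.transpose_transpose,
      Matrix.mul_assoc, ← Matrix.mul_assoc W, (Matrix.mem_orthogonalGroup_iff _ _).1 hW, Matrix.one_mul]
  · simpa only [Matrix.transpose_mul, Matrix.transpose_transpose, Matrix.mul_assoc] using hd

open scoped MatrixOrder in
theorem exists_isSymmInvSqrt {S : Matrix (Fin p) (Fin p) ℝ} (hS : S.PosDef) :
    ∃ G, IsSymmInvSqrt S G := by
  have hS' : (S⁻¹).PosDef := hS.inv
  set G := CFC.sqrt S⁻¹ with hG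
  have hsq : G * G = S⁻¹ := CFC.sqrt_mul_sqrt_self _ hS'.posSemidef.nonneg
  have hpsd : G.PosSemidef := Matrix.nonneg_iff_posSemidef.1 (CFC.sqrt_nonneg S⁻¹)
  have hdet : G.det * G.det = (S⁻¹).det := by rw [← Matrix.det_mul, hsq]
  have hGd : G.PosDef := by
    refine hpsd.posDef_iff_det_ne_zero.2 fun h0 => ?_
    rw [h0, mul_zero] at hdet
    exact hS'.det_pos.ne hdet
  refine ⟨G, hGd, ?_⟩
  have ht : Gᵀ = G := by simpa using hpsd.isHermitian.eq
  unfold IsInvSqrt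
  -- A one-sided inverse of a square matrix is two-sided, so G(SG) = 1 may be checked as S(GG) = 1.
  rw [ht, Matrix.mul_assoc, mul_eq_one_comm, Matrix.mul_assoc, hsq]
  exact Matrix.mul_nonsing_inv _ (isUnit_iff_ne_zero.2 hS.det_pos.ne')

/-- Conversely, the orthogonal matrix is recovered as W = (ΓL⁻¹)ᵀ; its orthogonality is ΓᵀΓ = S⁻¹ =
LᵀL. -/
theorem isLeftEstimate_iff {N : Fin 2} {X : Fin n → Matrix (Fin p) (Fin q) ℝ}
    (hl : (leftCov X).PosDef) (hr : (rightCov X).PosDef) {Γ : Matrix (Fin p) (Fin p) ℝ} :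
    IsLeftEstimate N X Γ ↔ Γ ∈ diagonalizers (leftCov X)⁻¹ (fobiMat N X) := by
  refine ⟨IsLeftEstimate.mem_diagonalizers, fun ⟨h1, h2⟩ => ?_⟩
  obtain ⟨L, hL⟩ := exists_isSymmInvSqrt hl
  obtain ⟨R, hR⟩ := exists_isSymmInvSqrt hr
  have hu : IsUnit L.det := isUnit_iff_ne_zero.2 hL.1.det_pos.ne'
  have e : Γ * L⁻¹ * L = Γ := by
    rw [Matrix.mul_assoc, Matrix.nonsing_inv_mul _ hu, Matrix.mul_one]
  refine ⟨L, R, (Γ * L⁻¹)ᵀ, hL, hR, ?_, ?_, ?_⟩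
  · rw [Matrix.mem_orthogonalGroup_iff, Matrix.transpose_transpose, Matrix.transpose_mul,
      Matrix.mul_assoc, ← Matrix.mul_assoc Γᵀ, h1, ← hL.2.transpose_mul_self,
      Matrix.mul_assoc, Matrix.mul_nonsing_inv _ hu, Matrix.mul_one, ← Matrix.transpose_mul,
      Matrix.mul_nonsing_inv _ hu, Matrix.transpose_one]
  · rw [leftFobi_standardized N hL.2 hR.2, Matrix.transpose_transpose]
    have : Γ * L⁻¹ * (L * fobiMat N X * Lᵀ) * (Γ * L⁻¹)ᵀ
        = (Γ * L⁻¹ * L) * fobiMat N X * (Γ * L⁻¹ * L)ᵀ := by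
      simp only [Matrix.transpose_mul, Matrix.mul_assoc]
    rw [this, e]
    exact h2
  · rw [Matrix.transpose_transpose, e]

theorem fobiTerm_transpose (N : Fin 2) (Y : Matrix (Fin p) (Fin q) ℝ) :
    (fobiTerm N Y)ᵀ = fobiTerm N Y := by
  unfold fobiTerm
  split_ifs <;> simp [Matrix.mul_assoc]

theorem leftFobi_transpose (N : Fin 2) (Y : Fin n → Matrix (Fin p) (Fin q) ℝ) :
    (leftFobi N Y)ᵀ = leftFobi N Y := by
  simp [leftFobi, Matrix.transpose_sum, fobiTerm_transpose]

theorem exists_isLeftEstimate (N : Fin 2) {X : Fin n → Matrix (Fin p) (Fin q) ℝ}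
    (hl : (leftCov X).PosDef) (hr : (rightCov X).PosDef) :
    ∃ Γ, IsLeftEstimate N X Γ := by
  obtain ⟨L, hL⟩ := exists_isSymmInvSqrt hl
  obtain ⟨R, hR⟩ := exists_isSymmInvSqrt hr
  have hB : (leftFobi N (standardized L R X)).IsHermitian := by
    simpa [Matrix.IsHermitian] using leftFobi_transpose N (standardized L R X)
  refine ⟨_, L, R, hB.eigenvectorUnitary, hL, hR, hB.eigenvectorUnitary.2, ?_, rfl⟩
  have h := hB.conjStarAlgAut_star_eigenvectorUnitary
  rw [Unitary.conjStarAlgAut_apply] at h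
  simp only [Unitary.coe_star, Matrix.star_eq_conjTranspose,
    Matrix.conjTranspose_eq_transpose_of_trivial, Matrix.transpose_transpose] at h
  rw [h]
  exact Matrix.isDiag_diagonal _

theorem leftCov_posSemidef (X : Fin n → Matrix (Fin p) (Fin q) ℝ) : (leftCov X).PosSemidef := by
  refine Matrix.PosSemidef.smul (Matrix.posSemidef_sum _ fun i _ => ?_) (by positivity)
  simpa using Matrix.posSemidef_self_mul_conjTranspose (centered X i)

theorem rightCov_posSemidef (X : Fin n → Matrix (Fin p) (Fin q) ℝ) :
    (rightCov X).PosSemidef := by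
  refine Matrix.PosSemidef.smul (Matrix.posSemidef_sum _ fun i _ => ?_) (by positivity)
  simpa using Matrix.posSemidef_conjTranspose_mul_self (centered X i)

/-- The rows of a diagonalizer are generalized eigenvectors. -/
theorem sum_diagonalizer_eq_zero {S C Γ : Matrix (Fin p) (Fin p) ℝ} (hS : S.det ≠ 0)
    (hΓ : Γ ∈ diagonalizers S⁻¹ C) (k k' : Fin p) :
    ∑ m, Γ k m * (C m k' - (Γ * C * Γᵀ) k k * S m k') = 0 := by
  obtain ⟨h1, h2⟩ := hΓ
  have h3 : Γᵀ * Γ * S = 1 := by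
    rw [h1, Matrix.nonsing_inv_mul _ (isUnit_iff_ne_zero.2 hS)]
  -- Inserting ΓᵀΓS = 1 behind C turns the diagonality of ΓCΓᵀ into a row-by-row eigenvalue
  -- equation.
  have h4 : Γ * C = Γ * C * Γᵀ * (Γ * S) := by
    calc Γ * C = Γ * C * (Γᵀ * Γ * S) := by rw [h3, Matrix.mul_one]
      _ = _ := by simp only [Matrix.mul_assoc]
  have h5 : (Γ * C) k k' = (Γ * C * Γᵀ) k k * (Γ * S) k k' := by
    nth_rewrite 1 [h4]
    rw [Matrix.mul_apply, Finset.sum_eq_single k]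
    · intro b _ hb
      rw [h2 (Ne.symm hb), zero_mul]
    · simp
  simp only [mul_sub, Finset.sum_sub_distrib]
  rw [sub_eq_zero]
  calc ∑ m, Γ k m * C m k' = (Γ * C) k k' := (Matrix.mul_apply).symm
    _ = _ := h5
    _ = _ := by
      rw [Matrix.mul_apply (M := Γ) (N := S), Finset.mul_sum]
      exact Finset.sum_congr rfl fun m _ => by ring

/-- The entry Q_bb is the squared length of column b of Γ. -/
theorem sq_le_of_mem_diagonalizers {Q C Γ : Matrix (Fin p) (Fin p) ℝ}
    (hΓ : Γ ∈ diagonalizers Q C) (a b : Fin p) : Γ a b ^ 2 ≤ Q b b := by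
  rw [← hΓ.1, Matrix.mul_apply]
  have := Finset.single_le_sum (f := fun j => Γᵀ b j * Γ j b) (s := Finset.univ)
    (fun j _ => mul_self_nonneg _) (Finset.mem_univ a)
  simpa [sq] using this

/-! ### Compactness and measurability of the sets of diagonalizers -/

/-- The matrices with entries in `[-M, M]`. -/
def box (p : ℕ) (M : ℝ) : Set (Matrix (Fin p) (Fin p) ℝ) :=
  Set.univ.pi fun _ => Set.univ.pi fun _ => Set.Icc (-M) M

theorem mem_box {M : ℝ} {Γ : Matrix (Fin p) (Fin p) ℝ} :
    Γ ∈ box p M ↔ ∀ a b, |Γ a b| ≤ M := by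
  refine ⟨fun h a b => abs_le.2 (h a trivial b trivial), fun h a _ b _ => abs_le.1 (h a b)⟩

theorem isCompact_box (p : ℕ) (M : ℝ) : IsCompact (box p M) :=
  isCompact_univ_pi fun _ => isCompact_univ_pi fun _ => isCompact_Icc

instance : FirstCountableTopology (Matrix (Fin p) (Fin q) ℝ) :=
  inferInstanceAs (FirstCountableTopology (Fin p → Fin q → ℝ))

instance : SecondCountableTopology (Matrix (Fin p) (Fin q) ℝ) :=
  inferInstanceAs (SecondCountableTopology (Fin p → Fin q → ℝ))

instance : BorelSpace (Matrix (Fin p) (Fin q) ℝ) :=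
  inferInstanceAs (BorelSpace (Fin p → Fin q → ℝ))

theorem continuous_entry (a : Fin p) (b : Fin q) :
    Continuous fun A : Matrix (Fin p) (Fin q) ℝ => A a b :=
  (continuous_apply b).comp (continuous_apply a)

/-- Joint closedness in (Q, C, Γ) serves three purposes: closed fibres, measurable hit sets, and
limits of diagonalizers being diagonalizers of the limit. -/
theorem isClosed_diagonalizers_graph (p : ℕ) :
    IsClosed {x : (Matrix (Fin p) (Fin p) ℝ × Matrix (Fin p) (Fin p) ℝ) ×
      Matrix (Fin p) (Fin p) ℝ | x.2 ∈ diagonalizers x.1.1 x.1.2} := by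
  have h1 : Continuous fun x : (Matrix (Fin p) (Fin p) ℝ × Matrix (Fin p) (Fin p) ℝ) ×
      Matrix (Fin p) (Fin p) ℝ => x.2 * x.1.2 * x.2ᵀ :=
    (continuous_snd.matrix_mul (continuous_snd.comp continuous_fst)).matrix_mul
      continuous_snd.matrix_transpose
  refine IsClosed.inter (isClosed_eq (continuous_snd.matrix_transpose.matrix_mul continuous_snd)
    (continuous_fst.comp continuous_fst)) ?_
  have : {x : (Matrix (Fin p) (Fin p) ℝ × Matrix (Fin p) (Fin p) ℝ) ×
      Matrix (Fin p) (Fin p) ℝ | (x.2 * x.1.2 * x.2ᵀ).IsDiag}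
      = ⋂ (i : Fin p) (j : Fin p) (_ : i ≠ j), {x | (x.2 * x.1.2 * x.2ᵀ) i j = 0} := by
    ext x
    simp only [Set.mem_iInter]
    exact ⟨fun h i j hij => h hij, fun h i j hij => h i j hij⟩
  change IsClosed {x : (Matrix (Fin p) (Fin p) ℝ × Matrix (Fin p) (Fin p) ℝ) ×
      Matrix (Fin p) (Fin p) ℝ | (x.2 * x.1.2 * x.2ᵀ).IsDiag}
  rw [this]
  exact isClosed_iInter fun i => isClosed_iInter fun j => isClosed_iInter fun _ =>
    isClosed_eq ((continuous_entry i j).comp h1) continuous_const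

theorem isClosed_diagonalizers (Q C : Matrix (Fin p) (Fin p) ℝ) :
    IsClosed (diagonalizers Q C) :=
  (isClosed_diagonalizers_graph p).preimage (Continuous.prodMk_right (Q, C))

theorem diagonalizers_subset_box (Q C : Matrix (Fin p) (Fin p) ℝ) :
    diagonalizers Q C ⊆ box p (1 + ∑ b, |Q b b|) := by
  intro Γ hΓ
  rw [mem_box]
  intro a b
  have h1 := sq_le_of_mem_diagonalizers hΓ a b
  have h2 : |Q b b| ≤ ∑ b, |Q b b| :=
    Finset.single_le_sum (f := fun b => |Q b b|) (fun _ _ => abs_nonneg _) (Finset.mem_univ b)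
  have h3 := le_abs_self (Q b b)
  have h4 := abs_nonneg (Q b b)
  refine abs_le_of_sq_le_sq ?_ (by linarith)
  nlinarith

theorem isCompact_diagonalizers (Q C : Matrix (Fin p) (Fin p) ℝ) :
    IsCompact (diagonalizers Q C) :=
  (isCompact_box p _).of_isClosed_subset (isClosed_diagonalizers Q C)
    (diagonalizers_subset_box Q C)

/-- For diagonalizers restricted to a fixed box, the hit set is the projection of a closed set along
a compact factor, hence closed. Every diagonalizer lies in some box of integer size, so the full hit
set is a countable union of closed sets. -/
theorem measurableSet_diagonalizers_hit {F : Set (Matrix (Fin p) (Fin p) ℝ)} (hF : IsClosed F) :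
    MeasurableSet {θ : Matrix (Fin p) (Fin p) ℝ × Matrix (Fin p) (Fin p) ℝ |
      (diagonalizers θ.1 θ.2 ∩ F).Nonempty} := by
  have : {θ : Matrix (Fin p) (Fin p) ℝ × Matrix (Fin p) (Fin p) ℝ |
      (diagonalizers θ.1 θ.2 ∩ F).Nonempty}
      = ⋃ M : ℕ, Prod.fst '' {x : (Matrix (Fin p) (Fin p) ℝ × Matrix (Fin p) (Fin p) ℝ) ×
          box p (M : ℝ) | x.2.1 ∈ diagonalizers x.1.1 x.1.2 ∧ x.2.1 ∈ F} := by
    ext θ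
    simp only [Set.mem_iUnion]
    constructor
    · rintro ⟨Γ, h1, h2⟩
      obtain ⟨M, hM⟩ := exists_nat_ge (1 + ∑ b, |θ.1 b b|)
      have hb : Γ ∈ box p (M : ℝ) := mem_box.2 fun a b =>
        (mem_box.1 (diagonalizers_subset_box _ _ h1) a b).trans hM
      exact ⟨M, ⟨θ, ⟨Γ, hb⟩⟩, ⟨h1, h2⟩, rfl⟩
    · rintro ⟨M, ⟨θ', Γ, hb⟩, ⟨h1, h2⟩, rfl⟩
      exact ⟨Γ, h1, h2⟩
  rw [this]
  refine MeasurableSet.iUnion fun M => IsClosed.measurableSet ?_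
  have : CompactSpace (box p (M : ℝ)) := isCompact_iff_compactSpace.1 (isCompact_box p M)
  refine isClosedMap_fst_of_compactSpace _ ?_
  exact IsClosed.inter ((isClosed_diagonalizers_graph p).preimage
    (continuous_fst.prodMk (continuous_subtype_val.comp continuous_snd)))
    (hF.preimage (continuous_subtype_val.comp continuous_snd))

/-! ### Diagonalizers close to the identity -/

/-- The squared Frobenius distance to the identity matrix. -/
def distOne (Γ : Matrix (Fin p) (Fin p) ℝ) : ℝ :=
  ∑ a, ∑ b, (Γ a b - (1 : Matrix (Fin p) (Fin p) ℝ) a b) ^ 2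

theorem continuous_distOne : Continuous (distOne (p := p)) :=
  continuous_finsetSum _ fun a _ => continuous_finsetSum _ fun b _ =>
    ((continuous_entry a b).sub continuous_const).pow 2

theorem sq_le_distOne (Γ : Matrix (Fin p) (Fin p) ℝ) (a b : Fin p) :
    (Γ a b - (1 : Matrix (Fin p) (Fin p) ℝ) a b) ^ 2 ≤ distOne Γ := by
  refine le_trans ?_ (Finset.single_le_sum (f := fun a => ∑ b,
    (Γ a b - (1 : Matrix (Fin p) (Fin p) ℝ) a b) ^ 2)
    (fun i _ => Finset.sum_nonneg fun j _ => sq_nonneg _) (Finset.mem_univ a))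
  exact Finset.single_le_sum (f := fun b => (Γ a b - (1 : Matrix (Fin p) (Fin p) ℝ) a b) ^ 2)
    (fun j _ => sq_nonneg _) (Finset.mem_univ b)

/-- A diagonalizer of a diagonal matrix with distinct entries is a signed permutation matrix, so
that conjugation by it preserves diagonal matrices. -/
theorem isDiag_conj_of_mem_diagonalizers {lam : Fin p → ℝ} (hlam : Function.Injective lam)
    {J D : Matrix (Fin p) (Fin p) ℝ} (hJ : J ∈ diagonalizers 1 (Matrix.diagonal lam))
    (hD : D.IsDiag) : (Jᵀ * D * J).IsDiag := by
  obtain ⟨h1, h2⟩ := hJ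
  have h3 : J * Matrix.diagonal lam = J * Matrix.diagonal lam * Jᵀ * J := by
    rw [Matrix.mul_assoc _ Jᵀ J, h1, Matrix.mul_one]
  have h4 : ∀ a b, J a b * lam b = (J * Matrix.diagonal lam * Jᵀ) a a * J a b := by
    intro a b
    have h5 := congrFun (congrFun h3 a) b
    rw [Matrix.mul_diagonal, Matrix.mul_apply, Finset.sum_eq_single a] at h5
    · exact h5
    · intro c _ hc
      rw [h2 (Ne.symm hc), zero_mul]
    · simp
  intro b c hbc
  rw [Matrix.mul_apply]
  refine Finset.sum_eq_zero fun a _ => ?_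
  rw [Matrix.mul_apply, Finset.sum_eq_single a]
  -- Two nonzero entries in row a of J would give equal eigenvalues lam b and lam c, contradicting
  -- injectivity.
  · by_contra hne
    have hb : J a b ≠ 0 := fun h => hne (by simp [h])
    have hc : J a c ≠ 0 := fun h => hne (by simp [h])
    have e1 := h4 a b
    have e2 := h4 a c
    rw [mul_comm] at e1 e2
    exact hbc (hlam ((mul_right_cancel₀ hb e1).trans (mul_right_cancel₀ hc e2).symm))
  · intro d _ hd
    rw [hD hd, mul_zero]
  · simp

/-- By contradiction and compactness: along a bad sequence θ_n, diagonalizers G_n have a limit point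
J, which diagonalizes the limit pair. Conjugation by J preserves diagonal matrices, so JᵀG_n is
again a diagonalizer, and along the subsequence it tends to JᵀJ = 1. -/
theorem eventually_exists_diagonalizer {lam : Fin p → ℝ} (hlam : Function.Injective lam) {ε : ℝ}
    (hε : 0 < ε) :
    ∀ᶠ θ in 𝓝 ((1 : Matrix (Fin p) (Fin p) ℝ), Matrix.diagonal lam),
      (diagonalizers θ.1 θ.2).Nonempty → ∃ Γ ∈ diagonalizers θ.1 θ.2, distOne Γ < ε := by
  by_contra hcon
  obtain ⟨θ, hθ, hbad⟩ := exists_seq_forall_of_frequently (not_eventually.1 hcon)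
  push Not at hbad
  choose hne hbad using hbad
  choose G hG using hne
  -- Squared entries of G_n are bounded by diagonal entries of (θ_n).1, which tend to 1 and are
  -- eventually below 4 = 2².
  have hbox : ∀ᶠ n in atTop, G n ∈ box p 2 := by
    have : ∀ᶠ n in atTop, ∀ b, (θ n).1 b b < 4 := by
      refine eventually_all.2 fun b => ?_
      have h1 : Tendsto (fun n => (θ n).1 b b) atTop (𝓝 ((1 : Matrix (Fin p) (Fin p) ℝ) b b)) :=
        tendsto_matrix_iff.1 ((continuous_fst.tendsto _).comp hθ) b b
      exact h1.eventually_lt_const (by simp)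
    filter_upwards [this] with n hn
    refine mem_box.2 fun a b => abs_le_of_sq_le_sq ?_ (by norm_num)
    have := sq_le_of_mem_diagonalizers (hG n) a b
    have := hn b
    linarith
  obtain ⟨J, -, ns, hns, hJ⟩ := (isCompact_box p 2).tendsto_subseq' hbox.frequently
  have hJmem : J ∈ diagonalizers 1 (Matrix.diagonal lam) := by
    have := (isClosed_diagonalizers_graph p).mem_of_tendsto
      ((hθ.comp hns.tendsto_atTop).prodMk_nhds hJ) (Eventually.of_forall fun n => hG (ns n))
    exact this
  have hJJ : J * Jᵀ = 1 := mul_eq_one_comm.1 hJmem.1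
  have hlim : Tendsto (fun n => distOne (Jᵀ * G (ns n))) atTop (𝓝 0) := by
    have hc : Continuous fun A : Matrix (Fin p) (Fin p) ℝ => distOne (Jᵀ * A) :=
      continuous_distOne.comp (continuous_const.matrix_mul continuous_id)
    have := (hc.tendsto J).comp hJ
    rw [hJmem.1] at this
    simpa [distOne, Function.comp_def] using this
  obtain ⟨n, hn⟩ := (hlim.eventually_lt_const hε).exists
  refine (hbad (ns n) (Jᵀ * G (ns n)) ⟨?_, ?_⟩).not_gt hn
  · rw [Matrix.transpose_mul, Matrix.transpose_transpose, Matrix.mul_assoc, ← Matrix.mul_assoc J,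
      hJJ, Matrix.one_mul, (hG (ns n)).1]
  · have := isDiag_conj_of_mem_diagonalizers hlam hJmem (hG (ns n)).2
    simpa only [Matrix.transpose_mul, Matrix.transpose_transpose, Matrix.mul_assoc] using this

/-! ### Two rows -/

/-- Cayley–Hamilton for the 2 × 2 matrix YYᵀ, whose trace is the squared Frobenius norm. -/
theorem fobiTerm_zero_fin_two (Y : Matrix (Fin 2) (Fin q) ℝ) :
    fobiTerm 0 Y = fobiTerm 1 Y - (Y * Yᵀ).det • (1 : Matrix (Fin 2) (Fin 2) ℝ) := by
  have h : fobiTerm 0 Y = (Y * Yᵀ) * (Y * Yᵀ) := by simp [fobiTerm, Matrix.mul_assoc]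
  have h' : fobiTerm 1 Y = (Y * Yᵀ).trace • (Y * Yᵀ) := by simp [fobiTerm, frobSq_eq_trace]
  rw [h, h']
  generalize Y * Yᵀ = A
  ext i j
  fin_cases i <;> fin_cases j <;>
    simp [Matrix.mul_apply, Fin.sum_univ_two, Matrix.det_fin_two, Matrix.trace_fin_two] <;> ring

theorem leftFobi_zero_fin_two (Y : Fin n → Matrix (Fin 2) (Fin q) ℝ) :
    ∃ c : ℝ, leftFobi 0 Y = leftFobi 1 Y - c • (1 : Matrix (Fin 2) (Fin 2) ℝ) := by
  refine ⟨((q : ℝ)⁻¹ * (n : ℝ)⁻¹) * ∑ i, (Y i * (Y i)ᵀ).det, ?_⟩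
  simp only [leftFobi, fobiTerm_zero_fin_two, Finset.sum_sub_distrib, smul_sub, ← Finset.sum_smul,
    smul_smul]

theorem isEigenvector_sub_smul_one (B : Matrix (Fin p) (Fin p) ℝ) (c : ℝ) (v : Fin p → ℝ) :
    IsEigenvector (B - c • 1) v ↔ IsEigenvector B v := by
  unfold IsEigenvector
  refine and_congr_right fun _ => ⟨fun ⟨d, hd⟩ => ⟨d + c, ?_⟩, fun ⟨d, hd⟩ => ⟨d - c, ?_⟩⟩
  · rw [Matrix.sub_mulVec, Matrix.smul_mulVec, Matrix.one_mulVec, sub_eq_iff_eq_add] at hd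
    rw [hd, add_smul]
  · rw [Matrix.sub_mulVec, Matrix.smul_mulVec, Matrix.one_mulVec, hd, sub_smul]

theorem isEigenvector_leftFobi_fin_two (Y : Fin n → Matrix (Fin 2) (Fin q) ℝ) (v : Fin 2 → ℝ) :
    IsEigenvector (leftFobi 0 Y) v ↔ IsEigenvector (leftFobi 1 Y) v := by
  obtain ⟨c, hc⟩ := leftFobi_zero_fin_two Y
  rw [hc, isEigenvector_sub_smul_one]

/-- Conjugation by an orthogonal W fixes multiples of the identity, so it diagonalizes both FOBI
matrices or neither. -/
theorem isLeftEstimate_fin_two (X : Fin n → Matrix (Fin 2) (Fin q) ℝ)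
    (Γ : Matrix (Fin 2) (Fin 2) ℝ) : IsLeftEstimate 0 X Γ ↔ IsLeftEstimate 1 X Γ := by
  unfold IsLeftEstimate
  refine exists_congr fun L => exists_congr fun R => exists_congr fun W =>
    and_congr_right fun _ => and_congr_right fun _ => and_congr_right fun hW =>
    and_congr_left fun _ => ?_
  obtain ⟨c, hc⟩ := leftFobi_zero_fin_two (standardized L R X)
  have hd : (c • (1 : Matrix (Fin 2) (Fin 2) ℝ)).IsDiag := Matrix.isDiag_one.smul c
  rw [hc, Matrix.mul_sub, Matrix.sub_mul, Matrix.mul_smul, Matrix.mul_one, Matrix.smul_mul,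
    (Matrix.mem_orthogonalGroup_iff' _ _).1 hW]
  exact ⟨fun h => by simpa using h.add hd, fun h => h.sub hd⟩

/-! ### Moments of the entries -/

section Moments

variable {p q : ℕ} {Ω : Type*} [MeasurableSpace Ω] {P : Measure Ω}
  {Z : ℕ → Ω → Matrix (Fin p) (Fin q) ℝ}

/-- The entry of a matrix at a pair of indices. -/
def ent (u : Fin p × Fin q) (z : Matrix (Fin p) (Fin q) ℝ) : ℝ := z u.1 u.2

@[fun_prop]
theorem measurable_ent (u : Fin p × Fin q) : Measurable (ent u) :=
  (measurable_pi_apply u.2).comp (measurable_pi_apply u.1)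

/-- The function `f` depends only on the entries in `S`. -/
def DependsOnEntries (f : Matrix (Fin p) (Fin q) ℝ → ℝ) (S : Finset (Fin p × Fin q)) : Prop :=
  ∀ z z', (∀ u ∈ S, ent u z = ent u z') → f z = f z'

/-- The third moment of an entry. -/
noncomputable def skew (P : Measure Ω) (Z : ℕ → Ω → Matrix (Fin p) (Fin q) ℝ)
    (u : Fin p × Fin q) : ℝ :=
  ∫ ω, ent u (Z 0 ω) ^ 3 ∂P

theorem memLp_two_of_four {f g : Ω → ℝ} (hf : MemLp f 4 P) (hg : MemLp g 4 P) :
    MemLp (fun ω => f ω * g ω) 2 P := by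
  have : ENNReal.HolderTriple 4 4 2 := ⟨by
    rw [← two_mul, show (4 : ENNReal) = 2 * 2 by norm_num,
      ENNReal.mul_inv (by simp) (by simp), ← mul_assoc,
      ENNReal.mul_inv_cancel (by simp) (by simp), one_mul]⟩
  exact hg.mul' hf

theorem integrable_mul_of_two {f g : Ω → ℝ} (hf : MemLp f 2 P) (hg : MemLp g 2 P) :
    Integrable (fun ω => f ω * g ω) P :=
  hf.integrable_mul hg

namespace IsSample

theorem isIID (h : IsSample P Z) : IsIID P Z := ⟨h.measurable, h.indep, h.identDistrib⟩

theorem measurable_zero (h : IsSample P Z) : Measurable (Z 0) := h.measurable 0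

theorem integral_mul_of_disjoint (h : IsSample P Z) {f g : Matrix (Fin p) (Fin q) ℝ → ℝ}
    (hf : Measurable f) (hg : Measurable g) (S T : Finset (Fin p × Fin q)) (hST : Disjoint S T)
    (hfS : DependsOnEntries f S) (hgT : DependsOnEntries g T) :
    ∫ ω, f (Z 0 ω) * g (Z 0 ω) ∂P = (∫ ω, f (Z 0 ω) ∂P) * ∫ ω, g (Z 0 ω) ∂P := by
  have hm : ∀ u : Fin p × Fin q, Measurable fun ω => Z 0 ω u.1 u.2 :=
    fun u => (measurable_ent u).comp h.measurable_zero
  have hind := h.indep_entries.indepFun_finset S T hST hm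
  -- Extension by zero turns a function of the whole matrix into one of the entries in S, so that
  -- independence of the two finite families applies.
  let ext (S : Finset (Fin p × Fin q)) (y : S → ℝ) : Matrix (Fin p) (Fin q) ℝ :=
    fun i j => if hu : (i, j) ∈ S then y ⟨(i, j), hu⟩ else 0
  have hext : ∀ S, Measurable (ext S) := by
    intro S
    refine measurable_pi_lambda _ fun i => measurable_pi_lambda _ fun j => ?_
    by_cases hu : (i, j) ∈ S
    · simpa [ext, hu] using measurable_pi_apply _
    · simp [ext, hu]
  have hind2 := hind.comp (hf.comp (hext S)) (hg.comp (hext T))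
  have e : ∀ (S : Finset (Fin p × Fin q)) (f : Matrix (Fin p) (Fin q) ℝ → ℝ),
      DependsOnEntries f S → ((f ∘ ext S) ∘ fun a (i : S) => Z 0 a i.1.1 i.1.2)
        = fun ω => f (Z 0 ω) := by
    intro S f hfS
    funext ω
    refine hfS _ _ fun u hu => ?_
    simp [ext, ent, hu]
  rw [e S f hfS, e T g hgT] at hind2
  exact hind2.integral_fun_mul_eq_mul_integral
    (hf.comp h.measurable_zero).aestronglyMeasurable
    (hg.comp h.measurable_zero).aestronglyMeasurable

theorem memLp_ent (h : IsSample P Z) (u : Fin p × Fin q) :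
    MemLp (fun ω => ent u (Z 0 ω)) 8 P := h.memLp u.1 u.2

theorem memLp_ent_mul (h : IsSample P Z) (u v : Fin p × Fin q) :
    MemLp (fun ω => ent u (Z 0 ω) * ent v (Z 0 ω)) 4 P := by
  have : ENNReal.HolderTriple 8 8 4 := ⟨by
    rw [← two_mul, show (8 : ENNReal) = 2 * 4 by norm_num,
      ENNReal.mul_inv (by simp) (by simp), ← mul_assoc,
      ENNReal.mul_inv_cancel (by simp) (by simp), one_mul]⟩
  exact (h.memLp_ent v).mul' (h.memLp_ent u)

theorem memLp_ent_mul4 (h : IsSample P Z) (u v w x : Fin p × Fin q) :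
    MemLp (fun ω => ent u (Z 0 ω) * ent v (Z 0 ω) * (ent w (Z 0 ω) * ent x (Z 0 ω))) 2 P :=
  memLp_two_of_four (h.memLp_ent_mul u v) (h.memLp_ent_mul w x)

section
variable [IsProbabilityMeasure P]

theorem memLp_two_ent (h : IsSample P Z) (u : Fin p × Fin q) :
    MemLp (fun ω => ent u (Z 0 ω)) 2 P :=
  (h.memLp_ent u).mono_exponent (by norm_num)

theorem memLp_two_ent_mul (h : IsSample P Z) (u v : Fin p × Fin q) :
    MemLp (fun ω => ent u (Z 0 ω) * ent v (Z 0 ω)) 2 P :=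
  (h.memLp_ent_mul u v).mono_exponent (by norm_num)

theorem memLp_two_ent_mul3 (h : IsSample P Z) (u v w : Fin p × Fin q) :
    MemLp (fun ω => ent u (Z 0 ω) * ent v (Z 0 ω) * ent w (Z 0 ω)) 2 P :=
  memLp_two_of_four (h.memLp_ent_mul u v) ((h.memLp_ent w).mono_exponent (by norm_num))

end

theorem integral_ent (h : IsSample P Z) (u : Fin p × Fin q) : ∫ ω, ent u (Z 0 ω) ∂P = 0 :=
  h.mean u.1 u.2

theorem integral_ent_sq (h : IsSample P Z) (u : Fin p × Fin q) :
    ∫ ω, ent u (Z 0 ω) ^ 2 ∂P = 1 := by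
  rw [← h.variance u.1 u.2, variance_of_integral_eq_zero _ (h.mean u.1 u.2)]
  · rfl
  · exact (h.memLp u.1 u.2).aemeasurable

/-- An entry that is isolated from the others makes the moment vanish. -/
theorem integral_ent_mul_eq_zero (h : IsSample P Z) (u : Fin p × Fin q)
    {f : Matrix (Fin p) (Fin q) ℝ → ℝ} (hf : Measurable f)
    (hfu : DependsOnEntries f {u}ᶜ) : ∫ ω, ent u (Z 0 ω) * f (Z 0 ω) ∂P = 0 := by
  rw [h.integral_mul_of_disjoint (measurable_ent u) hf {u} {u}ᶜ disjoint_compl_right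
    (fun z z' hz => hz u (by simp)) hfu, h.integral_ent, zero_mul]

theorem integral_ent_mul (h : IsSample P Z) (u v : Fin p × Fin q) :
    ∫ ω, ent u (Z 0 ω) * ent v (Z 0 ω) ∂P = if u = v then 1 else 0 := by
  split_ifs with huv
  · subst huv
    simpa only [sq] using h.integral_ent_sq u
  · exact h.integral_ent_mul_eq_zero u (measurable_ent v)
      fun z z' hz => hz v (by simpa using Ne.symm huv)

theorem integral_ent_mul3_of_ne (h : IsSample P Z) {u v w : Fin p × Fin q} (hv : v ≠ u)
    (hw : w ≠ u) : ∫ ω, ent u (Z 0 ω) * ent v (Z 0 ω) * ent w (Z 0 ω) ∂P = 0 := by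
  simp only [mul_assoc]
  refine h.integral_ent_mul_eq_zero u (f := fun z => ent v z * ent w z) (by fun_prop) ?_
  intro z z' hz
  simp only [hz v (by simpa using hv), hz w (by simpa using hw)]

theorem integral_ent_mul3 (h : IsSample P Z) (u v w : Fin p × Fin q) :
    ∫ ω, ent u (Z 0 ω) * ent v (Z 0 ω) * ent w (Z 0 ω) ∂P
      = if u = v ∧ v = w then skew P Z u else 0 := by
  by_cases huv : u = v
  · subst huv
    by_cases huw : u = w
    · subst huw
      simp only [and_self, if_true, skew]
      exact integral_congr_ae (Eventually.of_forall fun ω => by ring)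
    · have := h.integral_ent_mul3_of_ne huw huw
      simp only [huw, and_false, if_false]
      rw [← this]
      exact integral_congr_ae (Eventually.of_forall fun ω => by ring)
  · by_cases huw : u = w
    · subst huw
      have := h.integral_ent_mul3_of_ne huv huv
      simp only [huv, false_and, if_false]
      rw [← this]
      exact integral_congr_ae (Eventually.of_forall fun ω => by ring)
    · rw [h.integral_ent_mul3_of_ne (Ne.symm huv) (Ne.symm huw)]
      simp [huv]

theorem integral_ent_mul4_of_ne (h : IsSample P Z) {u v w x : Fin p × Fin q} (hv : v ≠ u)
    (hw : w ≠ u) (hx : x ≠ u) :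
    ∫ ω, ent u (Z 0 ω) * ent v (Z 0 ω) * (ent w (Z 0 ω) * ent x (Z 0 ω)) ∂P = 0 := by
  simp only [mul_assoc]
  refine h.integral_ent_mul_eq_zero u (f := fun z => ent v z * (ent w z * ent x z))
    (by fun_prop) ?_
  intro z z' hz
  simp only [hz v (by simpa using hv), hz w (by simpa using hw), hz x (by simpa using hx)]

theorem integral_ent_sq_mul (h : IsSample P Z) (u w x : Fin p × Fin q) :
    ∫ ω, ent u (Z 0 ω) * ent u (Z 0 ω) * (ent w (Z 0 ω) * ent x (Z 0 ω)) ∂P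
      = if w = x then (if u = w then kurt P (Z 0) u.1 u.2 else 1) else 0 := by
  by_cases hwx : w = x
  · subst hwx
    simp only [if_true]
    by_cases huw : u = w
    · subst huw
      simp only [if_true, kurt, ent]
      exact integral_congr_ae (Eventually.of_forall fun ω => by ring)
    · rw [if_neg huw, h.integral_mul_of_disjoint (f := fun z => ent u z * ent u z)
        (g := fun z => ent w z * ent w z) (by fun_prop) (by fun_prop) {u} {w}
        (by simpa using huw) (fun z z' hz => by simp only [hz u (by simp)])
        (fun z z' hz => by simp only [hz w (by simp)])]
      simp [h.integral_ent_mul]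
  -- As w ≠ x, one of the two is different from all other indices: w if x = u, and x otherwise. That
  -- isolated centered entry annihilates the moment.
  · rw [if_neg hwx]
    by_cases hux : x = u
    · have := h.integral_ent_mul4_of_ne (u := w) (v := u) (w := u) (x := x) (by grind) (by grind)
        (by grind)
      rw [← this]
      exact integral_congr_ae (Eventually.of_forall fun ω => by ring)
    · have := h.integral_ent_mul4_of_ne (u := x) (v := u) (w := u) (x := w) (by grind) (by grind)
        (by grind)
      rw [← this]
      exact integral_congr_ae (Eventually.of_forall fun ω => by ring)

/-- Fourth order moments with two different rows, off the diagonal. -/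
theorem integral_ent_mul4_offDiag (h : IsSample P Z) {k k' : Fin p} (hk : k ≠ k') (c d : Fin p)
    (a b e f : Fin q) :
    ∫ ω, ent (k, a) (Z 0 ω) * ent (c, b) (Z 0 ω) * (ent (d, e) (Z 0 ω) * ent (k', f) (Z 0 ω)) ∂P
      = (if c = k ∧ b = a ∧ d = k' ∧ e = f then 1 else 0)
        + (if d = k ∧ e = a ∧ c = k' ∧ b = f then 1 else 0) := by
  -- The entry (k, a) needs a partner, and (k', f) is excluded because k ≠ k'; the partner is (c, b)
  -- or (d, e). No kurtosis can appear.
  by_cases h1 : c = k ∧ b = a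
  · obtain ⟨rfl, rfl⟩ := h1
    rw [h.integral_ent_sq_mul]
    simp only [Prod.mk.injEq]
    grind
  by_cases h2 : d = k ∧ e = a
  · obtain ⟨rfl, rfl⟩ := h2
    have := h.integral_ent_sq_mul (d, e) (c, b) (k', f)
    have h3 : ∫ ω, ent (d, e) (Z 0 ω) * ent (c, b) (Z 0 ω) *
        (ent (d, e) (Z 0 ω) * ent (k', f) (Z 0 ω)) ∂P = ∫ ω, ent (d, e) (Z 0 ω) *
        ent (d, e) (Z 0 ω) * (ent (c, b) (Z 0 ω) * ent (k', f) (Z 0 ω)) ∂P :=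
      integral_congr_ae (Eventually.of_forall fun ω => by ring)
    rw [h3, this]
    simp only [Prod.mk.injEq]
    grind
  · rw [h.integral_ent_mul4_of_ne (by grind) (by grind) (by grind)]
    grind

end IsSample

end Moments

/-! ### Asymptotic linearity of the sample moments -/

theorem AsympLin.congr_influence {Ω : Type*} [MeasurableSpace Ω] {E : Type*} [MeasurableSpace E]
    {P : Measure Ω} {Z : ℕ → Ω → E} {b : ℕ × Ω → ℝ} {c c' : ℝ} {φ φ' : E → ℝ}
    (h : AsympLin P Z b c φ) (hc : c' = c) (hφ : ∀ z, φ' z = φ z) : AsympLin P Z b c' φ' := by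
  obtain rfl : φ' = φ := funext hφ
  exact hc ▸ h

/-- Contraction with a matrix that tends to the identity. -/
theorem AsympLin.contract {Ω : Type*} [MeasurableSpace Ω] {E : Type*} [MeasurableSpace E]
    {P : Measure Ω} [IsProbabilityMeasure P] {Z : ℕ → Ω → E} (hZ : IsIID P Z) {m : ℕ}
    {A F : Fin m → Fin m → ℕ × Ω → ℝ} {α φ : Fin m → Fin m → E → ℝ} {c : Fin m → Fin m → ℝ}
    (hA : ∀ a b, AsympLin P Z (A a b) ((1 : Matrix (Fin m) (Fin m) ℝ) a b) (α a b))
    (hF : ∀ a b, AsympLin P Z (F a b) (c a b) (φ a b)) :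
    AsympLin P Z (fun x => ∑ a, ∑ b, A a b x * F a b x) (∑ a, c a a)
      (fun z => ∑ a, φ a a z + ∑ a, ∑ b, α a b z * c a b) := by
  refine (AsympLin.sum Finset.univ fun a _ => AsympLin.sum Finset.univ fun b _ =>
    (hA a b).mul (hF a b) hZ).congr_influence ?_ fun z => ?_
  · simp [Matrix.one_apply]
  · simp [Matrix.one_apply, Finset.sum_add_distrib]

theorem mean_mul_centered (n : ℕ) (hn : 0 < n) (f g : ℕ → ℝ) :
    (n : ℝ)⁻¹ * ∑ i ∈ Finset.range n, (f i - (n : ℝ)⁻¹ * ∑ j ∈ Finset.range n, f j) *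
        (g i - (n : ℝ)⁻¹ * ∑ j ∈ Finset.range n, g j)
      = (n : ℝ)⁻¹ * ∑ i ∈ Finset.range n, f i * g i
        - ((n : ℝ)⁻¹ * ∑ j ∈ Finset.range n, f j) * ((n : ℝ)⁻¹ * ∑ j ∈ Finset.range n, g j) := by
  have h0 : (n : ℝ) ≠ 0 := by positivity
  obtain ⟨s, hs⟩ : ∃ s, s = (n : ℝ)⁻¹ * ∑ j ∈ Finset.range n, f j := ⟨_, rfl⟩
  obtain ⟨t, ht⟩ : ∃ t, t = (n : ℝ)⁻¹ * ∑ j ∈ Finset.range n, g j := ⟨_, rfl⟩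
  rw [← hs, ← ht]
  have hs' : ∑ j ∈ Finset.range n, f j = n * s := by rw [hs]; field_simp
  have ht' : ∑ j ∈ Finset.range n, g j = n * t := by rw [ht]; field_simp
  have e : ∀ i, (f i - s) * (g i - t) = f i * g i - t * f i - s * g i + s * t :=
    fun i => by ring
  simp only [e, Finset.sum_add_distrib, Finset.sum_sub_distrib, ← Finset.mul_sum, hs', ht',
    Finset.sum_const, Finset.card_range, nsmul_eq_mul]
  field_simp
  ring

/-- Expansion of the product. The coefficient −3 collects the constant term +1 and four terms −1, in
which a single variable is averaged to its own mean. -/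
theorem mean_mul4_centered (n : ℕ) (hn : 0 < n) (f g h k : ℕ → ℝ) {s t u v : ℝ}
    (hs : s = (n : ℝ)⁻¹ * ∑ j ∈ Finset.range n, f j)
    (ht : t = (n : ℝ)⁻¹ * ∑ j ∈ Finset.range n, g j)
    (hu : u = (n : ℝ)⁻¹ * ∑ j ∈ Finset.range n, h j)
    (hv : v = (n : ℝ)⁻¹ * ∑ j ∈ Finset.range n, k j) :
    (n : ℝ)⁻¹ * ∑ i ∈ Finset.range n, (f i - s) * (g i - t) * ((h i - u) * (k i - v))
      = (n : ℝ)⁻¹ * ∑ i ∈ Finset.range n, f i * g i * (h i * k i)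
        - s * ((n : ℝ)⁻¹ * ∑ i ∈ Finset.range n, g i * h i * k i)
        - t * ((n : ℝ)⁻¹ * ∑ i ∈ Finset.range n, f i * h i * k i)
        - u * ((n : ℝ)⁻¹ * ∑ i ∈ Finset.range n, f i * g i * k i)
        - v * ((n : ℝ)⁻¹ * ∑ i ∈ Finset.range n, f i * g i * h i)
        + s * t * ((n : ℝ)⁻¹ * ∑ i ∈ Finset.range n, h i * k i)
        + s * u * ((n : ℝ)⁻¹ * ∑ i ∈ Finset.range n, g i * k i)
        + s * v * ((n : ℝ)⁻¹ * ∑ i ∈ Finset.range n, g i * h i)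
        + t * u * ((n : ℝ)⁻¹ * ∑ i ∈ Finset.range n, f i * k i)
        + t * v * ((n : ℝ)⁻¹ * ∑ i ∈ Finset.range n, f i * h i)
        + u * v * ((n : ℝ)⁻¹ * ∑ i ∈ Finset.range n, f i * g i)
        - 3 * (s * t * (u * v)) := by
  have h0 : (n : ℝ) ≠ 0 := by positivity
  have hs' : ∑ j ∈ Finset.range n, f j = n * s := by rw [hs]; field_simp
  have ht' : ∑ j ∈ Finset.range n, g j = n * t := by rw [ht]; field_simp
  have hu' : ∑ j ∈ Finset.range n, h j = n * u := by rw [hu]; field_simp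
  have hv' : ∑ j ∈ Finset.range n, k j = n * v := by rw [hv]; field_simp
  clear hs ht hu hv
  have e : ∀ i, (f i - s) * (g i - t) * ((h i - u) * (k i - v))
      = f i * g i * (h i * k i) - s * (g i * h i * k i) - t * (f i * h i * k i)
        - u * (f i * g i * k i) - v * (f i * g i * h i) + s * t * (h i * k i)
        + s * u * (g i * k i) + s * v * (g i * h i) + t * u * (f i * k i) + t * v * (f i * h i)
        + u * v * (f i * g i) - t * u * v * f i - s * u * v * g i - s * t * v * h i
        - s * t * u * k i + s * t * u * v := fun i => by ring
  simp only [e, Finset.sum_add_distrib, Finset.sum_sub_distrib, ← Finset.mul_sum, hs', ht',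
    hu', hv', Finset.sum_const, Finset.card_range, nsmul_eq_mul]
  field_simp
  ring

section Sample

variable {p q : ℕ} {Ω : Type*} {Z : ℕ → Ω → Matrix (Fin p) (Fin q) ℝ}

/-- The first `n` observations. -/
def sampleData (Z : ℕ → Ω → Matrix (Fin p) (Fin q) ℝ) (x : ℕ × Ω) :
    Fin x.1 → Matrix (Fin p) (Fin q) ℝ :=
  fun i => Z i x.2

/-- Sample means. -/
noncomputable def sampleMean (Z : ℕ → Ω → Matrix (Fin p) (Fin q) ℝ)
    (f : Matrix (Fin p) (Fin q) ℝ → ℝ) (x : ℕ × Ω) : ℝ :=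
  (x.1 : ℝ)⁻¹ * ∑ i ∈ Finset.range x.1, f (Z i x.2)

/-- Centered entries of the observations. -/
noncomputable def centEnt (Z : ℕ → Ω → Matrix (Fin p) (Fin q) ℝ) (x : ℕ × Ω) (i : ℕ)
    (u : Fin p × Fin q) : ℝ :=
  ent u (Z i x.2) - sampleMean Z (ent u) x

/-- Sample covariances. -/
noncomputable def centMean2 (Z : ℕ → Ω → Matrix (Fin p) (Fin q) ℝ) (u v : Fin p × Fin q)
    (x : ℕ × Ω) : ℝ :=
  (x.1 : ℝ)⁻¹ * ∑ i ∈ Finset.range x.1, centEnt Z x i u * centEnt Z x i v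

/-- Fourth centered sample moments. -/
noncomputable def centMean4 (Z : ℕ → Ω → Matrix (Fin p) (Fin q) ℝ) (u v w y : Fin p × Fin q)
    (x : ℕ × Ω) : ℝ :=
  (x.1 : ℝ)⁻¹ * ∑ i ∈ Finset.range x.1,
    centEnt Z x i u * centEnt Z x i v * (centEnt Z x i w * centEnt Z x i y)

/-- Third moments of the entries. -/
noncomputable def mom3 [MeasurableSpace Ω] (P : Measure Ω)
    (Z : ℕ → Ω → Matrix (Fin p) (Fin q) ℝ)
    (u v w : Fin p × Fin q) : ℝ :=
  ∫ ω, ent u (Z 0 ω) * ent v (Z 0 ω) * ent w (Z 0 ω) ∂P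

/-- Fourth moments of the entries. -/
noncomputable def mom4 [MeasurableSpace Ω] (P : Measure Ω)
    (Z : ℕ → Ω → Matrix (Fin p) (Fin q) ℝ)
    (u v w y : Fin p × Fin q) : ℝ :=
  ∫ ω, ent u (Z 0 ω) * ent v (Z 0 ω) * (ent w (Z 0 ω) * ent y (Z 0 ω)) ∂P

/-- The influence function of a fourth centered sample moment. -/
noncomputable def infl4 [MeasurableSpace Ω] (P : Measure Ω)
    (Z : ℕ → Ω → Matrix (Fin p) (Fin q) ℝ)
    (u v w y : Fin p × Fin q) (z : Matrix (Fin p) (Fin q) ℝ) : ℝ :=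
  ent u z * ent v z * (ent w z * ent y z) - mom4 P Z u v w y - ent u z * mom3 P Z v w y
    - ent v z * mom3 P Z u w y - ent w z * mom3 P Z u v y - ent y z * mom3 P Z u v w

theorem centered_sampleData (x : ℕ × Ω) (i : Fin x.1) (a : Fin p) (b : Fin q) :
    centered (sampleData Z x) i a b = centEnt Z x i (a, b) := by
  simp only [centered, sampleData, centEnt, sampleMean, ent, Matrix.sub_apply, Matrix.smul_apply,
    Matrix.sum_apply, smul_eq_mul]
  rw [← Fin.sum_univ_eq_sum_range (fun i => Z i x.2 a b)]

theorem leftCov_sampleData (x : ℕ × Ω) (a b : Fin p) :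
    leftCov (sampleData Z x) a b = (q : ℝ)⁻¹ * ∑ l, centMean2 Z (a, l) (b, l) x := by
  simp only [leftCov, Matrix.smul_apply, Matrix.sum_apply, Matrix.mul_apply,
    Matrix.transpose_apply, centered_sampleData, smul_eq_mul, centMean2]
  rw [Finset.sum_comm, mul_assoc, Finset.mul_sum]
  congr 1
  refine Finset.sum_congr rfl fun l _ => ?_
  rw [← Fin.sum_univ_eq_sum_range (fun i => centEnt Z x i (a, l) * centEnt Z x i (b, l))]

theorem rightCov_sampleData (x : ℕ × Ω) (a b : Fin q) :
    rightCov (sampleData Z x) a b = (p : ℝ)⁻¹ * ∑ m, centMean2 Z (m, a) (m, b) x := by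
  simp only [rightCov, Matrix.smul_apply, Matrix.sum_apply, Matrix.mul_apply,
    Matrix.transpose_apply, centered_sampleData, smul_eq_mul, centMean2]
  rw [Finset.sum_comm, mul_assoc, Finset.mul_sum]
  congr 1
  refine Finset.sum_congr rfl fun l _ => ?_
  rw [← Fin.sum_univ_eq_sum_range (fun i => centEnt Z x i (l, a) * centEnt Z x i (l, b))]

theorem mul_mul_transpose_apply (R : Matrix (Fin q) (Fin q) ℝ) (x : Matrix (Fin p) (Fin q) ℝ)
    (k c : Fin p) : (x * R * xᵀ) k c = ∑ a, ∑ b, R a b * (x k a * x c b) := by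
  simp only [Matrix.mul_apply, Matrix.transpose_apply, Finset.sum_mul]
  rw [Finset.sum_comm]
  exact Finset.sum_congr rfl fun a _ => Finset.sum_congr rfl fun b _ => by ring

/-- Swapping the indices k and d accommodates both choices of N. The nesting of the contractions
with R, Q, R allows three applications of `AsympLin.contract`. -/
theorem fobiCore_apply (N : Fin 2) (Q : Matrix (Fin p) (Fin p) ℝ) (R : Matrix (Fin q) (Fin q) ℝ)
    (x : Matrix (Fin p) (Fin q) ℝ) (k k' : Fin p) :
    fobiCore N Q R x k k' = ∑ a, ∑ b, R a b * ∑ c, ∑ d, Q c d * ∑ e, ∑ f, R e f *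
      (x (if N = 0 then k else d) a * x c b * (x (if N = 0 then d else k) e * x k' f)) := by
  have key : ∀ r r' : Fin p → Fin p,
      ∑ a, ∑ b, R a b * ∑ c, ∑ d, Q c d * ∑ e, ∑ f, R e f *
        (x (r d) a * x c b * (x (r' d) e * x k' f))
      = ∑ c, ∑ d, Q c d * ((x * R * xᵀ) (r d) c * (x * R * xᵀ) (r' d) k') := by
    intro r r'
    have : ∀ a b c d, ∑ e, ∑ f, R e f * (x (r d) a * x c b * (x (r' d) e * x k' f))
        = x (r d) a * x c b * (x * R * xᵀ) (r' d) k' := by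
      intro a b c d
      rw [mul_mul_transpose_apply, Finset.mul_sum]
      refine Finset.sum_congr rfl fun e _ => ?_
      rw [Finset.mul_sum]
      exact Finset.sum_congr rfl fun f _ => by ring
    simp only [this]
    simp only [Finset.mul_sum]
    have swap : ∀ F : Fin q → Fin q → Fin p → Fin p → ℝ,
        ∑ a, ∑ b, ∑ c, ∑ d, F a b c d = ∑ c, ∑ d, ∑ a, ∑ b, F a b c d := by
      intro F
      calc _ = ∑ a, ∑ c, ∑ b, ∑ d, F a b c d :=
            Finset.sum_congr rfl fun a _ => Finset.sum_comm
        _ = ∑ a, ∑ c, ∑ d, ∑ b, F a b c d :=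
            Finset.sum_congr rfl fun a _ => Finset.sum_congr rfl fun c _ => Finset.sum_comm
        _ = ∑ c, ∑ a, ∑ d, ∑ b, F a b c d := Finset.sum_comm
        _ = _ := Finset.sum_congr rfl fun c _ => Finset.sum_comm
    rw [swap]
    refine Finset.sum_congr rfl fun c _ => Finset.sum_congr rfl fun d _ => ?_
    rw [mul_mul_transpose_apply R x (r d) c, Finset.sum_mul, Finset.mul_sum]
    refine Finset.sum_congr rfl fun a _ => ?_
    rw [Finset.sum_mul, Finset.mul_sum]
    exact Finset.sum_congr rfl fun b _ => by ring
  unfold fobiCore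
  split_ifs with hN
  · rw [key (fun _ => k) (fun d => d)]
    simp only [Matrix.mul_apply (M := x * R * xᵀ * Q), Matrix.mul_apply (M := x * R * xᵀ) (N := Q),
      Finset.sum_mul]
    rw [Finset.sum_comm]
    exact Finset.sum_congr rfl fun a _ => Finset.sum_congr rfl fun b _ => by ring
  · rw [key (fun d => d) (fun _ => k), Matrix.smul_apply, smul_eq_mul, Matrix.trace]
    simp only [Matrix.diag_apply, Matrix.mul_apply (M := x * R * xᵀ) (N := Q), Finset.sum_mul]
    rw [Finset.sum_comm]
    exact Finset.sum_congr rfl fun a _ => Finset.sum_congr rfl fun b _ => by ring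

theorem fobiMat_sampleData (N : Fin 2) (x : ℕ × Ω) (k k' : Fin p) :
    fobiMat N (sampleData Z x) k k' = (q : ℝ)⁻¹ * ∑ a, ∑ b, (rightCov (sampleData Z x))⁻¹ a b *
      ∑ c, ∑ d, (leftCov (sampleData Z x))⁻¹ c d *
      ∑ e, ∑ f, (rightCov (sampleData Z x))⁻¹ e f *
        centMean4 Z ((if N = 0 then k else d), a) (c, b) ((if N = 0 then d else k), e) (k', f) x := by
  have e4 : ∀ u v w y, centMean4 Z u v w y x = (x.1 : ℝ)⁻¹ * ∑ i : Fin x.1,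
      centEnt Z x i u * centEnt Z x i v * (centEnt Z x i w * centEnt Z x i y) := by
    intro u v w y
    rw [centMean4, ← Fin.sum_univ_eq_sum_range
      (fun i => centEnt Z x i u * centEnt Z x i v * (centEnt Z x i w * centEnt Z x i y))]
  simp only [fobiMat, Matrix.smul_apply, Matrix.sum_apply, smul_eq_mul, fobiCore_apply,
    centered_sampleData, e4]
  rw [mul_assoc]
  congr 1
  have pull : ∀ {m : ℕ} (A : Matrix (Fin m) (Fin m) ℝ) (F : Fin x.1 → Fin m → Fin m → ℝ),
      (x.1 : ℝ)⁻¹ * ∑ i, ∑ a, ∑ b, A a b * F i a b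
        = ∑ a, ∑ b, A a b * ((x.1 : ℝ)⁻¹ * ∑ i, F i a b) := by
    intro m A F
    rw [Finset.sum_comm, Finset.mul_sum]
    refine Finset.sum_congr rfl fun a _ => ?_
    rw [Finset.sum_comm, Finset.mul_sum]
    refine Finset.sum_congr rfl fun b _ => ?_
    rw [← Finset.mul_sum]
    ring
  simp only [pull]

namespace IsSample

variable [MeasurableSpace Ω] {P : Measure Ω} [IsProbabilityMeasure P]

theorem asympLin_sampleMean (h : IsSample P Z) (u : Fin p × Fin q) :
    AsympLin P Z (sampleMean Z (ent u)) 0 (ent u) :=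
  (asympLin_mean (measurable_ent u) (h.memLp_two_ent u)).congr_influence
    (h.integral_ent u).symm fun z => by rw [h.integral_ent, sub_zero]

theorem asympLin_centMean2 (h : IsSample P Z) (u v : Fin p × Fin q) :
    AsympLin P Z (centMean2 Z u v) (if u = v then 1 else 0)
      (fun z => ent u z * ent v z - if u = v then 1 else 0) := by
  have h1 := asympLin_mean (P := P) (Z := Z) (f := fun z => ent u z * ent v z) (by fun_prop)
    (h.memLp_two_ent_mul u v)
  have h2 := (h.asympLin_sampleMean u).mul (h.asympLin_sampleMean v) h.isIID
  refine ((h1.sub h2).congr (b' := centMean2 Z u v) ?_).congr_influence ?_ fun z => ?_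
  · filter_upwards [eventually_pos_whp P] with x hx
    exact mean_mul_centered x.1 hx (fun i => ent u (Z i x.2)) (fun i => ent v (Z i x.2))
  · rw [h.integral_ent_mul]; ring
  · rw [h.integral_ent_mul]; ring

/-- Terms with at least two sample means as factors have zero influence, since sample means of
entries are centered at 0. Only the terms with one mean contribute, through the third moments in
`infl4`. -/
theorem asympLin_centMean4 (h : IsSample P Z) (u v w y : Fin p × Fin q) :
    AsympLin P Z (centMean4 Z u v w y) (mom4 P Z u v w y) (infl4 P Z u v w y) := by
  have m1 := fun u => h.asympLin_sampleMean u
  have m2 := fun u v => asympLin_mean (P := P) (Z := Z) (f := fun z => ent u z * ent v z)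
    (by fun_prop) (h.memLp_two_ent_mul u v)
  have m3 := fun u v w => asympLin_mean (P := P) (Z := Z)
    (f := fun z => ent u z * ent v z * ent w z) (by fun_prop) (h.memLp_two_ent_mul3 u v w)
  have m4 := asympLin_mean (P := P) (Z := Z)
    (f := fun z => ent u z * ent v z * (ent w z * ent y z)) (by fun_prop)
    (h.memLp_ent_mul4 u v w y)
  have m11 := fun u v => (m1 u).mul (m1 v) h.isIID
  refine (AsympLin.congr (b' := centMean4 Z u v w y) (((((((((((m4.sub
    ((m1 u).mul (m3 v w y) h.isIID)).sub ((m1 v).mul (m3 u w y) h.isIID)).sub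
    ((m1 w).mul (m3 u v y) h.isIID)).sub ((m1 y).mul (m3 u v w) h.isIID)).add
    ((m11 u v).mul (m2 w y) h.isIID)).add ((m11 u w).mul (m2 v y) h.isIID)).add
    ((m11 u y).mul (m2 v w) h.isIID)).add ((m11 v w).mul (m2 u y) h.isIID)).add
    ((m11 v y).mul (m2 u w) h.isIID)).add ((m11 w y).mul (m2 u v) h.isIID)).sub
    (((m11 u v).mul (m11 w y) h.isIID).const_mul 3)) ?_).congr_influence ?_ fun z => ?_
  · filter_upwards [eventually_pos_whp P] with x hx
    exact mean_mul4_centered x.1 hx (fun i => ent u (Z i x.2)) (fun i => ent v (Z i x.2))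
      (fun i => ent w (Z i x.2)) (fun i => ent y (Z i x.2)) rfl rfl rfl rfl
  · simp only [mom4]; ring
  · simp only [infl4, mom4, mom3]; ring

end IsSample

end Sample

/-! ### Influence functions of the covariance and FOBI matrices -/

section Influence

variable {p q : ℕ} {Ω : Type*} [MeasurableSpace Ω] {P : Measure Ω}
  {Z : ℕ → Ω → Matrix (Fin p) (Fin q) ℝ}

/-- The influence function of the left covariance matrix. -/
noncomputable def leftInfl (a b : Fin p) (z : Matrix (Fin p) (Fin q) ℝ) : ℝ :=
  (q : ℝ)⁻¹ * ∑ l, ent (a, l) z * ent (b, l) z - (1 : Matrix (Fin p) (Fin p) ℝ) a b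

/-- The influence function of the right covariance matrix. -/
noncomputable def rightInfl (a b : Fin q) (z : Matrix (Fin p) (Fin q) ℝ) : ℝ :=
  (p : ℝ)⁻¹ * ∑ m, ent (m, a) z * ent (m, b) z - (1 : Matrix (Fin q) (Fin q) ℝ) a b

theorem leftInfl_comm (a b : Fin p) (z : Matrix (Fin p) (Fin q) ℝ) :
    leftInfl a b z = leftInfl b a z := by
  simp only [leftInfl, Matrix.one_apply, mul_comm (ent (a, _) z), eq_comm (a := a)]

/-- Limits of the fourth centered sample moments that occur in the left FOBI matrix. -/
noncomputable def fobiMom (N : Fin 2) (P : Measure Ω) (Z : ℕ → Ω → Matrix (Fin p) (Fin q) ℝ)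
    (k k' : Fin p) (a b : Fin q) (c d : Fin p) (e f : Fin q) : ℝ :=
  mom4 P Z ((if N = 0 then k else d), a) (c, b) ((if N = 0 then d else k), e) (k', f)

/-- Influence functions of the fourth centered sample moments that occur in the left FOBI
matrix. -/
noncomputable def fobiInfl4 (N : Fin 2) (P : Measure Ω) (Z : ℕ → Ω → Matrix (Fin p) (Fin q) ℝ)
    (k k' : Fin p) (a b : Fin q) (c d : Fin p) (e f : Fin q)
    (z : Matrix (Fin p) (Fin q) ℝ) : ℝ :=
  infl4 P Z ((if N = 0 then k else d), a) (c, b) ((if N = 0 then d else k), e) (k', f) z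

/-- Kurtosis functional: the limits of the diagonal entries of the left FOBI matrix. -/
noncomputable def fobiEig (N : Fin 2) (P : Measure Ω) (Z : ℕ → Ω → Matrix (Fin p) (Fin q) ℝ)
    (k : Fin p) : ℝ :=
  rowKurt P (Z 0) k + if N = 0 then (p : ℝ) + q - 2 else (p : ℝ) * q - 1

namespace IsSample

theorem mom3_eq (h : IsSample P Z) (u v w : Fin p × Fin q) :
    mom3 P Z u v w = if u = v ∧ v = w then skew P Z u else 0 :=
  h.integral_ent_mul3 u v w

theorem fobiMom_offDiag (h : IsSample P Z) (N : Fin 2) {k k' : Fin p} (hk : k ≠ k')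
    (a b : Fin q) (c d : Fin p) (e f : Fin q) :
    fobiMom N P Z k k' a b c d e f
      = if N = 0 then (if c = k ∧ b = a ∧ d = k' ∧ e = f then 1 else 0)
          + (if d = k ∧ e = a ∧ c = k' ∧ b = f then 1 else 0)
        else (if c = k ∧ b = e ∧ d = k' ∧ a = f then 1 else 0)
          + (if d = k ∧ a = e ∧ c = k' ∧ b = f then 1 else 0) := by
  unfold fobiMom
  by_cases hN : N = 0
  · simp only [hN, if_true]
    exact h.integral_ent_mul4_offDiag hk c d a b e f
  · simp only [hN, if_false]
    -- Exchanging the first and third factors reduces N = 1 to the arrangement of N = 0.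
    rw [← h.integral_ent_mul4_offDiag hk c d e b a f]
    exact integral_congr_ae (Eventually.of_forall fun ω => by ring)

/-- A nonzero moment needs {c, d} = {k, k'}, impossible for c = d. Hence right standardization has
no first-order effect on off-diagonal entries. -/
theorem fobiMom_eq_zero (h : IsSample P Z) (N : Fin 2) {k k' : Fin p} (hk : k ≠ k')
    (a b : Fin q) (c : Fin p) (e f : Fin q) : fobiMom N P Z k k' a b c c e f = 0 := by
  rw [h.fobiMom_offDiag N hk]
  grind

theorem sum_fobiMom (h : IsSample P Z) (N : Fin 2) {k k' : Fin p} (hk : k ≠ k') (a : Fin q)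
    (c d : Fin p) :
    ∑ e, fobiMom N P Z k k' a a c d e e
      = (if N = 0 then (q : ℝ) else 1) * (if c = k then if d = k' then 1 else 0 else 0)
        + if c = k' then if d = k then 1 else 0 else 0 := by
  have e1 : ∑ e : Fin q, (if c = k ∧ a = a ∧ d = k' ∧ e = e then (1 : ℝ) else 0)
      = q * if c = k then if d = k' then 1 else 0 else 0 := by
    by_cases h1 : c = k <;> by_cases h2 : d = k' <;> simp [h1, h2]
  have e2 : ∑ e : Fin q, (if d = k ∧ e = a ∧ c = k' ∧ a = e then (1 : ℝ) else 0)
      = if c = k' then if d = k then 1 else 0 else 0 := by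
    rw [Finset.sum_eq_single a (by grind) (by simp)]
    grind
  have e3 : ∑ e : Fin q, (if c = k ∧ a = e ∧ d = k' ∧ a = e then (1 : ℝ) else 0)
      = if c = k then if d = k' then 1 else 0 else 0 := by
    rw [Finset.sum_eq_single a (by grind) (by simp)]
    grind
  have e4 : ∑ e : Fin q, (if d = k ∧ a = e ∧ c = k' ∧ a = e then (1 : ℝ) else 0)
      = if c = k' then if d = k then 1 else 0 else 0 := by
    rw [Finset.sum_eq_single a (by grind) (by simp)]
    grind
  by_cases hN : N = 0
  · rw [if_pos hN, ← e1, ← e2, ← Finset.sum_add_distrib]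
    exact Finset.sum_congr rfl fun e _ => (h.fobiMom_offDiag N hk a a c d e e).trans (if_pos hN)
  · rw [if_neg hN, one_mul]
    nth_rewrite 1 [← e3]
    rw [← e4, ← Finset.sum_add_distrib]
    exact Finset.sum_congr rfl fun e _ => (h.fobiMom_offDiag N hk a a c d e e).trans (if_neg hN)

theorem sum_fobiInfl4 (h : IsSample P Z) (N : Fin 2) {k k' : Fin p} (hk : k ≠ k')
    (z : Matrix (Fin p) (Fin q) ℝ) :
    ∑ a, ∑ c, ∑ e, fobiInfl4 N P Z k k' a a c c e e z
      = ∑ a, ∑ c, ∑ e, ent ((if N = 0 then k else c), a) z * ent (c, a) z *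
          (ent ((if N = 0 then c else k), e) z * ent (k', e) z)
        - ∑ l, (ent (k, l) z * skew P Z (k', l) + ent (k', l) z * skew P Z (k, l)) := by
  -- A third moment survives only if its three entries coincide, which forces a = e and c ∈ {k, k'}.
  have e1 : ∀ a c e, fobiInfl4 N P Z k k' a a c c e e z
      = ent ((if N = 0 then k else c), a) z * ent (c, a) z *
          (ent ((if N = 0 then c else k), e) z * ent (k', e) z)
        - ((if c = k' then if a = e then ent (k, e) z * skew P Z (k', e) else 0 else 0)
          + (if c = k then if a = e then ent (k', e) z * skew P Z (k, e) else 0 else 0)) := by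
    intro a c e
    have h0 := h.fobiMom_eq_zero N hk a a c e e
    unfold fobiMom at h0
    unfold fobiInfl4 infl4
    rw [h0]
    simp only [h.mom3_eq, Prod.mk.injEq]
    by_cases hN : N = 0 <;> simp only [hN, if_true, if_false] <;> grind
  simp only [e1, Finset.sum_sub_distrib, Finset.sum_add_distrib]
  congr 1
  congr 1 <;> simp

/-- Counting pairings: for N = 0 the patterns a = e and c = k contribute pq and q², and their
overlap carries the kurtosis correction; for N = 1 all pq² moments equal 1 except those with c = k,
a = e. -/
theorem sum_fobiMom_diag (h : IsSample P Z) (hq : 0 < q) (N : Fin 2) (k : Fin p) :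
    (q : ℝ)⁻¹ * ∑ a, ∑ c, ∑ e, fobiMom N P Z k k a a c c e e = fobiEig N P Z k := by
  have hq' : (q : ℝ) ≠ 0 := by positivity
  unfold fobiEig rowKurt
  by_cases hN : N = 0
  · have e1 : ∀ a c e, fobiMom N P Z k k a a c c e e = (if a = e then 1 else 0)
        + (if c = k then 1 else 0)
        + (if c = k then if a = e then kurt P (Z 0) k e - 2 else 0 else 0) := by
      intro a c e
      simp only [fobiMom, hN, if_true, mom4]
      by_cases hae : a = e
      · subst hae
        have : ∫ ω, ent (k, a) (Z 0 ω) * ent (c, a) (Z 0 ω) *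
            (ent (c, a) (Z 0 ω) * ent (k, a) (Z 0 ω)) ∂P = ∫ ω, ent (k, a) (Z 0 ω) *
            ent (k, a) (Z 0 ω) * (ent (c, a) (Z 0 ω) * ent (c, a) (Z 0 ω)) ∂P :=
          integral_congr_ae (Eventually.of_forall fun ω => by ring)
        rw [this, h.integral_ent_sq_mul]
        simp only [Prod.mk.injEq]
        grind
      · by_cases hc : c = k
        · subst hc
          rw [h.integral_ent_sq_mul]
          simp only [Prod.mk.injEq]
          grind
        · rw [h.integral_ent_mul4_of_ne (by grind) (by grind) (by grind)]
          grind
    rw [if_pos hN]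
    simp [e1, Finset.sum_add_distrib, Finset.sum_ite_irrel]
    field_simp
    ring
  · have e1 : ∀ a c e, fobiMom N P Z k k a a c c e e = 1
        + (if c = k then if a = e then kurt P (Z 0) k e - 1 else 0 else 0) := by
      intro a c e
      simp only [fobiMom, hN, if_false, mom4]
      rw [h.integral_ent_sq_mul]
      simp only [Prod.mk.injEq]
      grind
    rw [if_neg hN]
    simp [e1, Finset.sum_add_distrib, Finset.sum_ite_irrel]
    field_simp
    ring

variable [IsProbabilityMeasure P]

theorem asympLin_leftCov (h : IsSample P Z) (hq : 0 < q) (a b : Fin p) :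
    AsympLin P Z (fun x => leftCov (sampleData Z x) a b) ((1 : Matrix (Fin p) (Fin p) ℝ) a b)
      (leftInfl a b) := by
  have hq' : (q : ℝ) ≠ 0 := by positivity
  simp only [leftCov_sampleData]
  refine ((AsympLin.sum Finset.univ fun l _ =>
    h.asympLin_centMean2 (a, l) (b, l)).const_mul (q : ℝ)⁻¹).congr_influence ?_ fun z => ?_
  · by_cases hab : a = b <;> simp [hab, hq', Matrix.one_apply]
  · by_cases hab : a = b
    · simp [hab, leftInfl, Matrix.one_apply, mul_sub, hq']
    · simp [hab, leftInfl]

theorem asympLin_rightCov (h : IsSample P Z) (hp : 0 < p) (a b : Fin q) :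
    AsympLin P Z (fun x => rightCov (sampleData Z x) a b) ((1 : Matrix (Fin q) (Fin q) ℝ) a b)
      (rightInfl a b) := by
  have hp' : (p : ℝ) ≠ 0 := by positivity
  simp only [rightCov_sampleData]
  refine ((AsympLin.sum Finset.univ fun l _ =>
    h.asympLin_centMean2 (l, a) (l, b)).const_mul (p : ℝ)⁻¹).congr_influence ?_ fun z => ?_
  · by_cases hab : a = b <;> simp [hab, hp', Matrix.one_apply]
  · by_cases hab : a = b
    · simp [hab, rightInfl, Matrix.one_apply, mul_sub, hp']
    · simp [hab, rightInfl]

theorem asympLin_fobiMat (h : IsSample P Z) (hp : 0 < p) (hq : 0 < q) (N : Fin 2)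
    (k k' : Fin p) :
    AsympLin P Z (fun x => fobiMat N (sampleData Z x) k k')
      ((q : ℝ)⁻¹ * ∑ a, ∑ c, ∑ e, fobiMom N P Z k k' a a c c e e)
      (fun z => (q : ℝ)⁻¹ * (∑ a, (∑ c, (∑ e, fobiInfl4 N P Z k k' a a c c e e z
            + ∑ e, ∑ f, -rightInfl e f z * fobiMom N P Z k k' a a c c e f)
          + ∑ c, ∑ d, -leftInfl c d z * ∑ e, fobiMom N P Z k k' a a c d e e)
        + ∑ a, ∑ b, -rightInfl a b z * ∑ c, ∑ e, fobiMom N P Z k k' a b c c e e)) := by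
  have hL := AsympLin.inv h.isIID (h.asympLin_leftCov hq)
  have hR := AsympLin.inv h.isIID (h.asympLin_rightCov hp)
  simp only [fobiMat_sampleData]
  exact (AsympLin.contract h.isIID hR fun a b => AsympLin.contract h.isIID hL fun c d =>
    AsympLin.contract h.isIID hR fun e f => h.asympLin_centMean4 _ _ _ _).const_mul _

/-- Apart from the fourth moments themselves, only the derivative of the inverse left covariance
matrix contributes. The index pairs (c, d) = (k, k') and (k', k) yield the coefficients q (or 1 for
N = 1) and 1. -/
theorem asympLin_fobiMat_offDiag (h : IsSample P Z) (hp : 0 < p) (hq : 0 < q) (N : Fin 2)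
    {k k' : Fin p} (hk : k ≠ k') :
    AsympLin P Z (fun x => fobiMat N (sampleData Z x) k k') 0
      (fun z => (q : ℝ)⁻¹ * (∑ a, ∑ c, ∑ e, ent ((if N = 0 then k else c), a) z * ent (c, a) z *
          (ent ((if N = 0 then c else k), e) z * ent (k', e) z)
        - ∑ l, (ent (k, l) z * skew P Z (k', l) + ent (k', l) z * skew P Z (k, l)))
        - (if N = 0 then (q : ℝ) + 1 else 2) * leftInfl k k' z) := by
  have hq' : (q : ℝ) ≠ 0 := by positivity
  refine (h.asympLin_fobiMat hp hq N k k').congr_influence ?_ fun z => ?_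
  · simp [h.fobiMom_eq_zero N hk]
  · simp only [h.fobiMom_eq_zero N hk, h.sum_fobiMom N hk, Finset.sum_add_distrib, mul_zero,
      Finset.sum_const_zero, add_zero, h.sum_fobiInfl4 N hk]
    simp only [mul_add, Finset.sum_add_distrib, mul_ite, mul_one, mul_zero, Finset.sum_ite_eq',
      Finset.mem_univ, if_true, Finset.sum_const_zero, Finset.sum_ite_irrel, Finset.sum_const,
      Finset.card_univ, Fintype.card_fin, nsmul_eq_mul, leftInfl_comm k' k]
    by_cases hN : N = 0
    · simp only [hN, if_true]
      field_simp
      ring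
    · simp only [hN, if_false]
      field_simp
      ring

end IsSample

end Influence

/-! ### The asymptotic variances -/

section Variance

variable {p q : ℕ} {Ω : Type*} [MeasurableSpace Ω] {P : Measure Ω}
  {Z : ℕ → Ω → Matrix (Fin p) (Fin q) ℝ}

/-- The influence function of an off-diagonal entry of the left MFOBI estimate, up to the factor
`(fobiEig k' - fobiEig k)⁻¹`. -/
noncomputable def score (N : Fin 2) (P : Measure Ω) (Z : ℕ → Ω → Matrix (Fin p) (Fin q) ℝ)
    (k k' : Fin p) (z : Matrix (Fin p) (Fin q) ℝ) : ℝ :=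
  fobiEig N P Z k * leftInfl k k' z -
    ((q : ℝ)⁻¹ * (∑ a, ∑ c, ∑ e, ent ((if N = 0 then k else c), a) z * ent (c, a) z *
          (ent ((if N = 0 then c else k), e) z * ent (k', e) z)
        - ∑ l, (ent (k, l) z * skew P Z (k', l) + ent (k', l) z * skew P Z (k, l)))
        - (if N = 0 then (q : ℝ) + 1 else 2) * leftInfl k k' z)

/-- The part of the score that depends on the rows `k` and `k'` only. -/
noncomputable def scoreCommon (P : Measure Ω) (Z : ℕ → Ω → Matrix (Fin p) (Fin q) ℝ)
    (k k' : Fin p) (z : Matrix (Fin p) (Fin q) ℝ) : ℝ :=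
  (rowKurt P (Z 0) k + 2 * q + 1 - ∑ l, ent (k, l) z * ent (k, l) z
      - ∑ l, ent (k', l) z * ent (k', l) z) * ((q : ℝ)⁻¹ * ∑ l, ent (k, l) z * ent (k', l) z)
    + (q : ℝ)⁻¹ * ∑ l, (ent (k, l) z * skew P Z (k', l) + ent (k', l) z * skew P Z (k, l))

/-- The coefficients with which the other rows enter the score. -/
noncomputable def rowNoise (N : Fin 2) (m : Fin p) (a b : Fin q)
    (z : Matrix (Fin p) (Fin q) ℝ) : ℝ :=
  if N = 0 then (1 : Matrix (Fin q) (Fin q) ℝ) a b - ent (m, a) z * ent (m, b) z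
  else (1 : Matrix (Fin q) (Fin q) ℝ) a b * ∑ l, (1 - ent (m, l) z * ent (m, l) z)

/-- The part of the score that depends on the rows other than `k` and `k'`. -/
noncomputable def scoreRest (N : Fin 2) (k k' : Fin p) (z : Matrix (Fin p) (Fin q) ℝ) : ℝ :=
  (q : ℝ)⁻¹ * ∑ m with m ≠ k ∧ m ≠ k', ∑ a, ∑ b,
    (ent (k, a) z * ent (k', b) z) * rowNoise N m a b z

theorem sum_eq_two_add {k k' : Fin p} (hk : k ≠ k') (F : Fin p → ℝ) :
    ∑ c, F c = F k + F k' + ∑ m with m ≠ k ∧ m ≠ k', F m := by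
  have h1 : (Finset.univ : Finset (Fin p))
      = insert k (insert k' (Finset.univ.filter fun m => m ≠ k ∧ m ≠ k')) := by
    ext m
    simp only [Finset.mem_univ, Finset.mem_insert, Finset.mem_filter, true_and, true_iff]
    tauto
  nth_rewrite 1 [h1]
  rw [Finset.sum_insert (by simp [hk]), Finset.sum_insert (by simp)]
  ring

theorem card_other_rows {k k' : Fin p} (hk : k ≠ k') :
    ((Finset.univ.filter fun m : Fin p => m ≠ k ∧ m ≠ k').card : ℝ) = p - 2 := by
  have := sum_eq_two_add hk fun _ => (1 : ℝ)
  simp only [Finset.sum_const, Finset.card_univ, Fintype.card_fin, nsmul_eq_mul, mul_one] at this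
  linarith

/-- Each of the p − 2 other rows enters through its deviation from its mean. The means, t or qt per
row with t the inner product of rows k and k', absorb the N-dependent constants, leaving the same
constant 2q + 1 for both N. -/
theorem score_eq (N : Fin 2) {k k' : Fin p} (hk : k ≠ k') (z : Matrix (Fin p) (Fin q) ℝ) :
    score N P Z k k' z = scoreCommon P Z k k' z + scoreRest N k k' z := by
  unfold score scoreCommon scoreRest leftInfl fobiEig
  rw [Matrix.one_apply_ne hk, sub_zero]
  generalize ∑ l, (ent (k, l) z * skew P Z (k', l) + ent (k', l) z * skew P Z (k, l)) = A
  obtain ⟨t, ht⟩ : ∃ t, t = ∑ l, ent (k, l) z * ent (k', l) z := ⟨_, rfl⟩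
  by_cases hN : N = 0
  · simp only [hN, if_true, rowNoise]
    have e1 : ∑ a, ∑ c, ∑ e, ent (k, a) z * ent (c, a) z * (ent (c, e) z * ent (k', e) z)
        = ∑ c, (∑ a, ent (k, a) z * ent (c, a) z) * ∑ e, ent (c, e) z * ent (k', e) z := by
      rw [Finset.sum_comm]
      exact Finset.sum_congr rfl fun c _ => (Finset.sum_mul_sum _ _ _ _).symm
    have e2 : ∀ m, ∑ a, ∑ b, (ent (k, a) z * ent (k', b) z) *
        ((1 : Matrix (Fin q) (Fin q) ℝ) a b - ent (m, a) z * ent (m, b) z)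
        = t - (∑ a, ent (k, a) z * ent (m, a) z) * ∑ e, ent (m, e) z * ent (k', e) z := by
      intro m
      simp only [mul_sub, Finset.sum_sub_distrib, ht]
      congr 1
      · simp [Matrix.one_apply]
      · rw [Finset.sum_mul_sum]
        exact Finset.sum_congr rfl fun a _ => Finset.sum_congr rfl fun b _ => by ring
    rw [e1, sum_eq_two_add hk]
    simp only [e2, Finset.sum_sub_distrib, Finset.sum_const, nsmul_eq_mul, card_other_rows hk,
      ← ht]
    ring
  · simp only [hN, if_false, rowNoise]
    have e1 : ∑ a, ∑ c, ∑ e, ent (c, a) z * ent (c, a) z * (ent (k, e) z * ent (k', e) z)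
        = ∑ c, (∑ a, ent (c, a) z * ent (c, a) z) * t := by
      rw [Finset.sum_comm, ht]
      exact Finset.sum_congr rfl fun c _ => (Finset.sum_mul_sum _ _ _ _).symm
    have e2 : ∀ m, ∑ a, ∑ b, (ent (k, a) z * ent (k', b) z) *
        ((1 : Matrix (Fin q) (Fin q) ℝ) a b * ∑ l, (1 - ent (m, l) z * ent (m, l) z))
        = t * q - (∑ a, ent (m, a) z * ent (m, a) z) * t := by
      intro m
      simp only [← mul_assoc, ← Finset.sum_mul]
      have : ∑ a, ∑ b, ent (k, a) z * ent (k', b) z * (1 : Matrix (Fin q) (Fin q) ℝ) a b = t := by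
        simp [Matrix.one_apply, ht]
      rw [this, Finset.sum_sub_distrib]
      simp only [Finset.sum_const, Finset.card_univ, Fintype.card_fin, nsmul_eq_mul, mul_one]
      ring
    rw [e1, sum_eq_two_add hk]
    simp only [e2]
    simp only [Finset.sum_sub_distrib, ← Finset.sum_mul, Finset.sum_const, nsmul_eq_mul, card_other_rows hk,
      ← ht]
    ring

@[fun_prop]
theorem measurable_rowNoise (N : Fin 2) (m : Fin p) (a b : Fin q) :
    Measurable (rowNoise N m a b) := by
  unfold rowNoise
  by_cases hN : N = 0
  · simp only [hN, if_true]; fun_prop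
  · simp only [hN, if_false]; fun_prop

@[fun_prop]
theorem measurable_scoreCommon (k k' : Fin p) : Measurable (scoreCommon P Z k k') := by
  unfold scoreCommon; fun_prop

/-- The entries of the rows other than row `m`. -/
def otherRows (m : Fin p) : Finset (Fin p × Fin q) := Finset.univ.filter fun u => u.1 ≠ m

/-- The entries of row `m`. -/
def oneRow (m : Fin p) : Finset (Fin p × Fin q) := Finset.univ.filter fun u => u.1 = m

theorem disjoint_rows (m : Fin p) : Disjoint (otherRows (q := q) m) (oneRow m) := by
  rw [Finset.disjoint_left]
  intro u h1 h2
  exact (Finset.mem_filter.1 h1).2 (Finset.mem_filter.1 h2).2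

theorem mem_otherRows {m c : Fin p} (h : c ≠ m) (a : Fin q) : (c, a) ∈ otherRows m := by
  simpa [otherRows] using h

theorem mem_oneRow (m : Fin p) (a : Fin q) : (m, a) ∈ oneRow m := by simp [oneRow]

theorem dependsOnEntries_rowNoise (N : Fin 2) {m : Fin p} {S : Finset (Fin p × Fin q)}
    (hS : ∀ a, (m, a) ∈ S) (a b : Fin q) : DependsOnEntries (rowNoise N m a b) S := by
  intro z z' hz
  simp only [rowNoise, hz _ (hS _)]

theorem dependsOnEntries_scoreCommon {k k' : Fin p} {S : Finset (Fin p × Fin q)}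
    (hk : ∀ a, (k, a) ∈ S) (hk' : ∀ a, (k', a) ∈ S) :
    DependsOnEntries (scoreCommon P Z k k') S := by
  intro z z' hz
  simp only [scoreCommon, hz _ (hk _), hz _ (hk' _)]

namespace IsSample

variable [IsProbabilityMeasure P]

theorem integral_rowNoise (h : IsSample P Z) (N : Fin 2) (m : Fin p) (a b : Fin q) :
    ∫ ω, rowNoise N m a b (Z 0 ω) ∂P = 0 := by
  have hi : ∀ a b, Integrable (fun ω => ent (m, a) (Z 0 ω) * ent (m, b) (Z 0 ω)) P :=
    fun a b => (h.memLp_two_ent_mul _ _).integrable (by norm_num)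
  unfold rowNoise
  by_cases hN : N = 0
  · simp only [hN, if_true]
    rw [integral_sub (integrable_const _) (hi a b), h.integral_ent_mul]
    simp [Matrix.one_apply]
  · simp only [hN, if_false]
    rw [integral_const_mul, integral_finsetSum]
    · have : ∀ l, ∫ ω, (1 - ent (m, l) (Z 0 ω) * ent (m, l) (Z 0 ω)) ∂P = 0 := by
        intro l
        rw [integral_sub (integrable_const _) (hi l l), h.integral_ent_mul]
        simp
      simp [this]
    · exact fun l _ => (integrable_const _).sub (hi l l)

theorem memLp_rowNoise (h : IsSample P Z) (N : Fin 2) (m : Fin p) (a b : Fin q) :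
    MemLp (fun ω => rowNoise N m a b (Z 0 ω)) 4 P := by
  unfold rowNoise
  by_cases hN : N = 0
  · simp only [hN, if_true]
    exact (memLp_const _).sub (h.memLp_ent_mul _ _)
  · simp only [hN, if_false]
    have h1 : ∀ l, MemLp (fun ω => 1 - ent (m, l) (Z 0 ω) * ent (m, l) (Z 0 ω)) 4 P :=
      fun l => (memLp_const _).sub (h.memLp_ent_mul _ _)
    have h2 : MemLp (fun ω => ∑ l, (1 - ent (m, l) (Z 0 ω) * ent (m, l) (Z 0 ω))) 4 P :=
      memLp_finsetSum _ fun l _ => h1 l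
    exact h2.const_mul _

theorem memLp_noiseTerm (h : IsSample P Z) (N : Fin 2) (k k' m : Fin p) (a b : Fin q) :
    MemLp (fun ω => ent (k, a) (Z 0 ω) * ent (k', b) (Z 0 ω) * rowNoise N m a b (Z 0 ω)) 2 P :=
  memLp_two_of_four (h.memLp_ent_mul _ _) (h.memLp_rowNoise N m a b)

theorem memLp_scoreCommon (h : IsSample P Z) (k k' : Fin p) :
    MemLp (fun ω => scoreCommon P Z k k' (Z 0 ω)) 2 P := by
  unfold scoreCommon
  have hs : ∀ i j : Fin p, MemLp (fun ω => ∑ l, ent (i, l) (Z 0 ω) * ent (j, l) (Z 0 ω)) 4 P :=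
    fun i j => memLp_finsetSum _ fun l _ => h.memLp_ent_mul _ _
  have h1 : MemLp (fun ω => ∑ l, (ent (k, l) (Z 0 ω) * skew P Z (k', l) +
      ent (k', l) (Z 0 ω) * skew P Z (k, l))) 2 P :=
    memLp_finsetSum _ fun l _ => ((h.memLp_two_ent _).mul_const _).add
      ((h.memLp_two_ent _).mul_const _)
  have h2 : MemLp (fun ω => rowKurt P (Z 0) k + 2 * q + 1 -
      ∑ l, ent (k, l) (Z 0 ω) * ent (k, l) (Z 0 ω) -
      ∑ l, ent (k', l) (Z 0 ω) * ent (k', l) (Z 0 ω)) 4 P :=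
    ((memLp_const _).sub (hs k k)).sub (hs k' k')
  exact (memLp_two_of_four h2 ((hs k k').const_mul _)).add (h1.const_mul _)

theorem memLp_scoreRest (h : IsSample P Z) (N : Fin 2) (k k' : Fin p) :
    MemLp (fun ω => scoreRest N k k' (Z 0 ω)) 2 P := by
  unfold scoreRest
  have h1 : MemLp (fun ω => ∑ m with m ≠ k ∧ m ≠ k', ∑ a, ∑ b,
      ent (k, a) (Z 0 ω) * ent (k', b) (Z 0 ω) * rowNoise N m a b (Z 0 ω)) 2 P :=
    memLp_finsetSum _ fun m _ => memLp_finsetSum _ fun a _ => memLp_finsetSum _ fun b _ =>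
      h.memLp_noiseTerm N k k' m a b
  exact h1.const_mul _

/-- Functions of the other rows are uncorrelated with the noise of a row. -/
theorem integral_mul_rowNoise (h : IsSample P Z) (N : Fin 2) (m : Fin p) (a b : Fin q)
    {f : Matrix (Fin p) (Fin q) ℝ → ℝ} (hf : Measurable f)
    (hfm : DependsOnEntries f (otherRows m)) :
    ∫ ω, f (Z 0 ω) * rowNoise N m a b (Z 0 ω) ∂P = 0 := by
  rw [h.integral_mul_of_disjoint hf (by fun_prop) _ _ (disjoint_rows m) hfm
    (dependsOnEntries_rowNoise N (mem_oneRow m) a b), h.integral_rowNoise, mul_zero]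

/-- In each summand the noise of row m is centered and independent of all other factors. -/
theorem integral_common_mul_rest (h : IsSample P Z) (N : Fin 2) (k k' : Fin p) :
    ∫ ω, scoreCommon P Z k k' (Z 0 ω) * scoreRest N k k' (Z 0 ω) ∂P = 0 := by
  have hint : ∀ m a b, Integrable (fun ω => scoreCommon P Z k k' (Z 0 ω) *
      (ent (k, a) (Z 0 ω) * ent (k', b) (Z 0 ω) * rowNoise N m a b (Z 0 ω))) P :=
    fun m a b => (h.memLp_scoreCommon k k').integrable_mul (h.memLp_noiseTerm N k k' m a b)
  have e : ∀ ω, scoreCommon P Z k k' (Z 0 ω) * scoreRest N k k' (Z 0 ω)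
      = (q : ℝ)⁻¹ * ∑ m with m ≠ k ∧ m ≠ k', ∑ a, ∑ b, scoreCommon P Z k k' (Z 0 ω) *
        (ent (k, a) (Z 0 ω) * ent (k', b) (Z 0 ω) * rowNoise N m a b (Z 0 ω)) := by
    intro ω
    simp only [scoreRest, ← Finset.mul_sum]
    ring
  simp only [e]
  rw [integral_const_mul, integral_finsetSum _ fun m _ => integrable_finsetSum _ fun a _ =>
    integrable_finsetSum _ fun b _ => hint m a b]
  rw [Finset.sum_eq_zero, mul_zero]
  intro m hm
  obtain ⟨hmk, hmk'⟩ := (Finset.mem_filter.1 hm).2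
  rw [integral_finsetSum _ fun a _ => integrable_finsetSum _ fun b _ => hint m a b]
  refine Finset.sum_eq_zero fun a _ => ?_
  rw [integral_finsetSum _ fun b _ => hint m a b]
  refine Finset.sum_eq_zero fun b _ => ?_
  simp only [← mul_assoc]
  refine h.integral_mul_rowNoise N m a b
    (f := fun z => scoreCommon P Z k k' z * ent (k, a) z * ent (k', b) z) (by fun_prop) ?_
  intro z z' hz
  have h1 := dependsOnEntries_scoreCommon (P := P) (Z := Z) (mem_otherRows (Ne.symm hmk))
    (mem_otherRows (Ne.symm hmk')) z z' hz
  simp only [h1, hz _ (mem_otherRows (Ne.symm hmk) _), hz _ (mem_otherRows (Ne.symm hmk') _)]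

/-- For different rows, the noise of m' integrates to zero. For equal rows, the factors from rows k
and k' separate, and their fourth moment is 1 when the column indices agree and 0 otherwise. -/
theorem integral_noiseTerm_mul (h : IsSample P Z) (N : Fin 2) {k k' m m' : Fin p} (hk : k ≠ k')
    (hm : m ≠ k ∧ m ≠ k') (hm' : m' ≠ k ∧ m' ≠ k') (a b a' b' : Fin q) :
    ∫ ω, (ent (k, a) (Z 0 ω) * ent (k', b) (Z 0 ω) * rowNoise N m a b (Z 0 ω)) *
      (ent (k, a') (Z 0 ω) * ent (k', b') (Z 0 ω) * rowNoise N m' a' b' (Z 0 ω)) ∂P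
      = if m = m' ∧ a = a' ∧ b = b' then ∫ ω, rowNoise N m a b (Z 0 ω) ^ 2 ∂P else 0 := by
  by_cases hmm : m = m'
  · subst hmm
    have e : ∀ ω, (ent (k, a) (Z 0 ω) * ent (k', b) (Z 0 ω) * rowNoise N m a b (Z 0 ω)) *
        (ent (k, a') (Z 0 ω) * ent (k', b') (Z 0 ω) * rowNoise N m a' b' (Z 0 ω))
        = (ent (k, a) (Z 0 ω) * ent (k', b) (Z 0 ω) *
            (ent (k, a') (Z 0 ω) * ent (k', b') (Z 0 ω))) *
          (rowNoise N m a b (Z 0 ω) * rowNoise N m a' b' (Z 0 ω)) := fun ω => by ring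
    simp only [e]
    rw [h.integral_mul_of_disjoint (f := fun z => ent (k, a) z * ent (k', b) z *
            (ent (k, a') z * ent (k', b') z))
          (g := fun z => rowNoise N m a b z * rowNoise N m a' b' z)
          (by fun_prop) (by fun_prop) _ _ (disjoint_rows m),
        h.integral_ent_mul4_offDiag hk]
    · by_cases hab : a = a' ∧ b = b'
      · obtain ⟨rfl, rfl⟩ := hab
        simp [hk.symm, sq]
      · have : ¬ (a' = a ∧ b = b') := fun hh => hab ⟨hh.1.symm, hh.2⟩
        simp [hk.symm, hab, this]
    · intro z z' hz
      simp only [hz _ (mem_otherRows (Ne.symm hm.1) _), hz _ (mem_otherRows (Ne.symm hm.2) _)]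
    · intro z z' hz
      simp only [dependsOnEntries_rowNoise N (mem_oneRow m) _ _ z z' hz]
  · rw [if_neg fun hh => hmm hh.1]
    simp only [← mul_assoc]
    refine h.integral_mul_rowNoise N m' a' b' (f := fun z => ent (k, a) z * ent (k', b) z *
      rowNoise N m a b z * ent (k, a') z * ent (k', b') z) (by fun_prop) ?_
    intro z z' hz
    simp only [hz _ (mem_otherRows (Ne.symm hm'.1) _), hz _ (mem_otherRows (Ne.symm hm'.2) _),
      dependsOnEntries_rowNoise N (mem_otherRows hmm) _ _ z z' hz]

theorem integral_rest_sq (h : IsSample P Z) (N : Fin 2) {k k' : Fin p} (hk : k ≠ k') :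
    ∫ ω, scoreRest N k k' (Z 0 ω) ^ 2 ∂P = ((q : ℝ)⁻¹) ^ 2 *
      ∑ m with m ≠ k ∧ m ≠ k', ∑ a, ∑ b, ∫ ω, rowNoise N m a b (Z 0 ω) ^ 2 ∂P := by
  let D := (Finset.univ.filter fun m : Fin p => m ≠ k ∧ m ≠ k') ×ˢ
    (Finset.univ : Finset (Fin q × Fin q))
  let T : Fin p × Fin q × Fin q → Ω → ℝ := fun j ω =>
    ent (k, j.2.1) (Z 0 ω) * ent (k', j.2.2) (Z 0 ω) * rowNoise N j.1 j.2.1 j.2.2 (Z 0 ω)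
  have hD : ∀ F : Fin p → Fin q → Fin q → ℝ, ∑ m with m ≠ k ∧ m ≠ k', ∑ a, ∑ b, F m a b
      = ∑ j ∈ D, F j.1 j.2.1 j.2.2 := by
    intro F
    rw [Finset.sum_product]
    refine Finset.sum_congr rfl fun m _ => ?_
    rw [Fintype.sum_prod_type]
  have hT : ∀ j, MemLp (T j) 2 P := fun j => h.memLp_noiseTerm N k k' j.1 j.2.1 j.2.2
  have e : ∀ ω, scoreRest N k k' (Z 0 ω) ^ 2
      = ((q : ℝ)⁻¹) ^ 2 * ∑ i ∈ D, ∑ j ∈ D, T i ω * T j ω := by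
    intro ω
    rw [scoreRest, mul_pow, hD fun m a b =>
      (ent (k, a) (Z 0 ω) * ent (k', b) (Z 0 ω)) * rowNoise N m a b (Z 0 ω), sq (∑ j ∈ D, _),
      Finset.sum_mul_sum]
  have hint : ∀ i j, Integrable (fun ω => T i ω * T j ω) P :=
    fun i j => (hT i).integrable_mul (hT j)
  simp only [e]
  rw [integral_const_mul, integral_finsetSum _ fun i _ => integrable_finsetSum _ fun j _ =>
    hint i j, hD fun m a b => ∫ ω, rowNoise N m a b (Z 0 ω) ^ 2 ∂P]
  congr 1
  refine Finset.sum_congr rfl fun i hi => ?_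
  rw [integral_finsetSum _ fun j _ => hint i j]
  have hmem : ∀ i ∈ D, i.1 ≠ k ∧ i.1 ≠ k' := fun i hi =>
    (Finset.mem_filter.1 (Finset.mem_product.1 hi).1).2
  rw [Finset.sum_eq_single i]
  · rw [h.integral_noiseTerm_mul N hk (hmem i hi) (hmem i hi)]
    simp
  · intro j hj hji
    rw [h.integral_noiseTerm_mul N hk (hmem i hi) (hmem j hj), if_neg]
    rintro ⟨h1, h2, h3⟩
    exact hji (Prod.ext h1.symm (Prod.ext h2.symm h3.symm))
  · exact fun hi' => absurd hi hi'

theorem integral_score_sq (h : IsSample P Z) (N : Fin 2) {k k' : Fin p} (hk : k ≠ k') :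
    ∫ ω, score N P Z k k' (Z 0 ω) ^ 2 ∂P = ∫ ω, scoreCommon P Z k k' (Z 0 ω) ^ 2 ∂P +
      ((q : ℝ)⁻¹) ^ 2 *
      ∑ m with m ≠ k ∧ m ≠ k', ∑ a, ∑ b, ∫ ω, rowNoise N m a b (Z 0 ω) ^ 2 ∂P := by
  have h1 := h.memLp_scoreCommon k k'
  have h2 := h.memLp_scoreRest N k k'
  have e : ∀ ω, score N P Z k k' (Z 0 ω) ^ 2 = scoreCommon P Z k k' (Z 0 ω) ^ 2
      + 2 * (scoreCommon P Z k k' (Z 0 ω) * scoreRest N k k' (Z 0 ω))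
      + scoreRest N k k' (Z 0 ω) ^ 2 := fun ω => by rw [score_eq N hk]; ring
  simp only [e]
  have h3 := (integrable_mul_of_two h1 h2).const_mul 2
  rw [integral_add (h1.integrable_sq.fun_add h3) h2.integrable_sq,
    integral_add h1.integrable_sq h3, integral_const_mul, h.integral_rest_sq N hk,
    h.integral_common_mul_rest]
  ring

theorem sum_integral_rowNoise_zero (h : IsSample P Z) (hq : 0 < q) (m : Fin p) :
    ∑ a, ∑ b, ∫ ω, rowNoise 0 m a b (Z 0 ω) ^ 2 ∂P
      = q * rowKurt P (Z 0) m + q ^ 2 - 2 * q := by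
  have hq' : (q : ℝ) ≠ 0 := by positivity
  -- The second moment is kurtosis minus 1 on the diagonal and 1 off it.
  have e : ∀ a b, ∫ ω, rowNoise 0 m a b (Z 0 ω) ^ 2 ∂P
      = 1 + if a = b then kurt P (Z 0) m a - 2 else 0 := by
    intro a b
    have h1 := h.memLp_two_ent_mul (m, a) (m, b)
    have h2 := h.memLp_ent_mul4 (m, a) (m, a) (m, b) (m, b)
    have e1 : ∀ ω, rowNoise 0 m a b (Z 0 ω) ^ 2 = (1 : Matrix (Fin q) (Fin q) ℝ) a b ^ 2
        - 2 * (1 : Matrix (Fin q) (Fin q) ℝ) a b * (ent (m, a) (Z 0 ω) * ent (m, b) (Z 0 ω))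
        + ent (m, a) (Z 0 ω) * ent (m, a) (Z 0 ω) * (ent (m, b) (Z 0 ω) * ent (m, b) (Z 0 ω)) := by
      intro ω
      simp only [rowNoise, if_true]
      ring
    simp only [e1]
    rw [integral_add ((integrable_const _).sub'
      ((h1.integrable (by norm_num)).const_mul _)) (h2.integrable (by norm_num)),
      integral_sub (integrable_const _) ((h1.integrable (by norm_num)).const_mul _),
      integral_const_mul, h.integral_ent_mul, h.integral_ent_sq_mul]
    by_cases hab : a = b
    · subst hab; simp; ring
    · simp [hab]
  simp only [e, Finset.sum_add_distrib, rowKurt]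
  simp
  field_simp
  ring

theorem sum_integral_rowNoise_one (h : IsSample P Z) (hq : 0 < q) (m : Fin p) :
    ∑ a, ∑ b, ∫ ω, rowNoise 1 m a b (Z 0 ω) ^ 2 ∂P
      = q * (q * rowKurt P (Z 0) m - q) := by
  have hq' : (q : ℝ) ≠ 0 := by positivity
  have hterm : ∀ l l', ∫ ω, (1 - ent (m, l) (Z 0 ω) * ent (m, l) (Z 0 ω)) *
      (1 - ent (m, l') (Z 0 ω) * ent (m, l') (Z 0 ω)) ∂P
      = if l = l' then kurt P (Z 0) m l - 1 else 0 := by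
    intro l l'
    have h1 := fun l => (h.memLp_two_ent_mul (m, l) (m, l)).integrable (by norm_num)
    have h2 := (h.memLp_ent_mul4 (m, l) (m, l) (m, l') (m, l')).integrable (by norm_num)
    have e1 : ∀ ω, (1 - ent (m, l) (Z 0 ω) * ent (m, l) (Z 0 ω)) *
        (1 - ent (m, l') (Z 0 ω) * ent (m, l') (Z 0 ω)) = 1 - ent (m, l) (Z 0 ω) * ent (m, l) (Z 0 ω)
        - ent (m, l') (Z 0 ω) * ent (m, l') (Z 0 ω)
        + ent (m, l) (Z 0 ω) * ent (m, l) (Z 0 ω) *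
          (ent (m, l') (Z 0 ω) * ent (m, l') (Z 0 ω)) := fun ω => by ring
    simp only [e1]
    rw [integral_add (((integrable_const _).sub' (h1 l)).sub' (h1 l')) h2,
      integral_sub ((integrable_const _).sub' (h1 l)) (h1 l'),
      integral_sub (integrable_const _) (h1 l), h.integral_ent_mul, h.integral_ent_mul,
      h.integral_ent_sq_mul]
    by_cases hll : l = l'
    · simp [hll]; ring
    · simp [hll]
  have hL : ∀ l, MemLp (fun ω => 1 - ent (m, l) (Z 0 ω) * ent (m, l) (Z 0 ω)) 2 P :=
    fun l => (memLp_const _).sub (h.memLp_two_ent_mul _ _)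
  -- The noise is the same on all q diagonal positions and zero elsewhere; its second moment is a
  -- sum of variances of squared entries.
  have e : ∀ a b, ∫ ω, rowNoise 1 m a b (Z 0 ω) ^ 2 ∂P
      = if a = b then ∑ l, (kurt P (Z 0) m l - 1) else 0 := by
    intro a b
    have e1 : ∀ ω, rowNoise 1 m a b (Z 0 ω) ^ 2 = (1 : Matrix (Fin q) (Fin q) ℝ) a b ^ 2 *
        ∑ l, ∑ l', (1 - ent (m, l) (Z 0 ω) * ent (m, l) (Z 0 ω)) *
          (1 - ent (m, l') (Z 0 ω) * ent (m, l') (Z 0 ω)) := by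
      intro ω
      rw [← Finset.sum_mul_sum]
      simp only [rowNoise, one_ne_zero, if_false]
      ring
    simp only [e1]
    rw [integral_const_mul, integral_finsetSum _ fun l _ => integrable_finsetSum _ fun l' _ =>
      integrable_mul_of_two (hL l) (hL l')]
    have e2 : ∀ l, ∫ ω, ∑ l', (1 - ent (m, l) (Z 0 ω) * ent (m, l) (Z 0 ω)) *
        (1 - ent (m, l') (Z 0 ω) * ent (m, l') (Z 0 ω)) ∂P = kurt P (Z 0) m l - 1 := by
      intro l
      rw [integral_finsetSum _ fun l' _ => integrable_mul_of_two (hL l) (hL l')]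
      simp [hterm]
    simp only [e2]
    by_cases hab : a = b
    · subst hab; simp
    · simp [hab]
  simp only [e, rowKurt]
  simp
  field_simp

end IsSample

end Variance

/-! ### Measurability of the covariance and FOBI matrices -/

section Measurability

variable {n p q : ℕ}

theorem continuous_centered (i : Fin n) :
    Continuous fun X : Fin n → Matrix (Fin p) (Fin q) ℝ => centered X i := by
  have h : Continuous fun X : Fin n → Matrix (Fin p) (Fin q) ℝ => ∑ j, X j :=
    continuous_finsetSum _ fun j _ => continuous_apply j
  exact (continuous_apply i).sub (h.const_smul (n : ℝ)⁻¹)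

theorem continuous_leftCov :
    Continuous (leftCov : (Fin n → Matrix (Fin p) (Fin q) ℝ) → Matrix (Fin p) (Fin p) ℝ) := by
  have h : Continuous fun X : Fin n → Matrix (Fin p) (Fin q) ℝ =>
      ∑ i, centered X i * (centered X i)ᵀ :=
    continuous_finsetSum _ fun i _ => (continuous_centered i).matrix_mul
      (continuous_centered i).matrix_transpose
  exact h.const_smul ((q : ℝ)⁻¹ * (n : ℝ)⁻¹)

theorem continuous_rightCov :
    Continuous (rightCov : (Fin n → Matrix (Fin p) (Fin q) ℝ) → Matrix (Fin q) (Fin q) ℝ) := by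
  have h : Continuous fun X : Fin n → Matrix (Fin p) (Fin q) ℝ =>
      ∑ i, (centered X i)ᵀ * centered X i :=
    continuous_finsetSum _ fun i _ => (continuous_centered i).matrix_transpose.matrix_mul
      (continuous_centered i)
  exact h.const_smul ((p : ℝ)⁻¹ * (n : ℝ)⁻¹)

theorem measurable_of_entries {α : Type*} [MeasurableSpace α] {f : α → Matrix (Fin p) (Fin q) ℝ}
    (h : ∀ a b, Measurable fun x => f x a b) : Measurable f :=
  measurable_pi_lambda _ fun a => measurable_pi_lambda _ fun b => h a b

theorem measurable_entry {α : Type*} [MeasurableSpace α] {f : α → Matrix (Fin p) (Fin q) ℝ}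
    (hf : Measurable f) (a : Fin p) (b : Fin q) : Measurable fun x => f x a b :=
  (measurable_pi_apply b).comp ((measurable_pi_apply a).comp hf)

/-- The formula det⁻¹ · adjugate holds for every matrix, with value 0 at singular ones, and real
inversion is measurable on all of ℝ. -/
theorem measurable_inv : Measurable fun A : Matrix (Fin p) (Fin p) ℝ => A⁻¹ := by
  have h1 : Measurable fun A : Matrix (Fin p) (Fin p) ℝ => A.det :=
    (continuous_id.matrix_det).measurable
  have h2 : Continuous fun A : Matrix (Fin p) (Fin p) ℝ => A.adjugate :=
    continuous_id.matrix_adjugate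
  refine measurable_of_entries fun a b => ?_
  simp only [Matrix.inv_def, Ring.inverse_eq_inv', Matrix.smul_apply, smul_eq_mul]
  exact h1.inv.mul ((continuous_entry a b).comp h2).measurable

theorem continuous_fobiCore (N : Fin 2) :
    Continuous fun y : Matrix (Fin p) (Fin p) ℝ × Matrix (Fin q) (Fin q) ℝ ×
      Matrix (Fin p) (Fin q) ℝ => fobiCore N y.1 y.2.1 y.2.2 := by
  have h : Continuous fun y : Matrix (Fin p) (Fin p) ℝ × Matrix (Fin q) (Fin q) ℝ ×
      Matrix (Fin p) (Fin q) ℝ => y.2.2 * y.2.1 * y.2.2ᵀ :=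
    ((continuous_snd.comp continuous_snd).matrix_mul
      (continuous_fst.comp continuous_snd)).matrix_mul
      (continuous_snd.comp continuous_snd).matrix_transpose
  unfold fobiCore
  by_cases hN : N = 0
  · simp only [hN, if_true]
    exact (h.matrix_mul continuous_fst).matrix_mul h
  · simp only [hN, if_false]
    exact (h.matrix_mul continuous_fst).matrix_trace.smul h

theorem measurable_leftCov_inv : Measurable fun X : Fin n → Matrix (Fin p) (Fin q) ℝ =>
    (leftCov X)⁻¹ :=
  measurable_inv.comp continuous_leftCov.measurable

theorem measurable_fobiCore_centered (N : Fin 2) (i : Fin n) :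
    Measurable fun X : Fin n → Matrix (Fin p) (Fin q) ℝ =>
      fobiCore N (leftCov X)⁻¹ (rightCov X)⁻¹ (centered X i) := by
  have h1 : Measurable fun X : Fin n → Matrix (Fin p) (Fin q) ℝ => (rightCov X)⁻¹ :=
    measurable_inv.comp continuous_rightCov.measurable
  have h2 : Measurable fun X : Fin n → Matrix (Fin p) (Fin q) ℝ =>
      ((leftCov X)⁻¹, (rightCov X)⁻¹, centered X i) :=
    measurable_leftCov_inv.prodMk (h1.prodMk (continuous_centered i).measurable)
  exact Measurable.comp
    (g := fun y : Matrix (Fin p) (Fin p) ℝ × Matrix (Fin q) (Fin q) ℝ × Matrix (Fin p) (Fin q) ℝ =>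
      fobiCore N y.1 y.2.1 y.2.2)
    (f := fun X : Fin n → Matrix (Fin p) (Fin q) ℝ =>
      ((leftCov X)⁻¹, (rightCov X)⁻¹, centered X i))
    (continuous_fobiCore N).measurable h2

theorem measurable_fobiMat (N : Fin 2) :
    Measurable (fobiMat N : (Fin n → Matrix (Fin p) (Fin q) ℝ) → Matrix (Fin p) (Fin p) ℝ) := by
  have h (i : Fin n) := measurable_fobiCore_centered (p := p) (q := q) N i
  refine measurable_of_entries fun a b => ?_
  simp only [fobiMat, Matrix.smul_apply, Matrix.sum_apply, smul_eq_mul]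
  have hs : Measurable fun X : Fin n → Matrix (Fin p) (Fin q) ℝ =>
      ∑ i, fobiCore N (leftCov X)⁻¹ (rightCov X)⁻¹ (centered X i) a b :=
    Finset.measurable_fun_sum _ fun i _ => measurable_entry (h i) a b
  exact hs.const_mul _

end Measurability

/-! ### Existence of a consistent sequence of estimators -/

section Estimators

variable {p q : ℕ}

open Classical in
/-- The candidate estimates: the diagonalizers if the sample covariance matrices are
nonsingular, and the identity matrix otherwise. -/
noncomputable def candidates (N : Fin 2) (n : ℕ) (X : Fin n → Matrix (Fin p) (Fin q) ℝ) :
    Set (Matrix (Fin p) (Fin p) ℝ) :=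
  if (leftCov X).det ≠ 0 ∧ (rightCov X).det ≠ 0 then
    diagonalizers (leftCov X)⁻¹ (fobiMat N X) else {1}

theorem isSelectable_candidates (N : Fin 2) (n : ℕ) :
    IsSelectable (candidates (p := p) (q := q) N n) := by
  refine ⟨fun X => ?_, fun X => ?_, fun X => ?_, fun F hF => ?_⟩
  · unfold candidates
    split_ifs
    · exact isCompact_diagonalizers _ _
    · exact isCompact_singleton
  · unfold candidates
    split_ifs
    · exact isClosed_diagonalizers _ _
    · exact isClosed_singleton
  · unfold candidates
    split_ifs with hX
    · obtain ⟨Γ, hΓ⟩ := exists_isLeftEstimate N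
        ((leftCov_posSemidef X).posDef_iff_det_ne_zero.2 hX.1)
        ((rightCov_posSemidef X).posDef_iff_det_ne_zero.2 hX.2)
      exact ⟨Γ, hΓ.mem_diagonalizers⟩
    · exact Set.singleton_nonempty _
  · have hdom : MeasurableSet {X : Fin n → Matrix (Fin p) (Fin q) ℝ |
        (leftCov X).det ≠ 0 ∧ (rightCov X).det ≠ 0} :=
      ((isOpen_ne_fun continuous_leftCov.matrix_det continuous_const).inter
        (isOpen_ne_fun continuous_rightCov.matrix_det continuous_const)).measurableSet
    have hhit : MeasurableSet {X : Fin n → Matrix (Fin p) (Fin q) ℝ |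
        (diagonalizers (leftCov X)⁻¹ (fobiMat N X) ∩ F).Nonempty} :=
      (measurable_leftCov_inv.prodMk (measurable_fobiMat N))
        (measurableSet_diagonalizers_hit hF)
    have hone : MeasurableSet {X : Fin n → Matrix (Fin p) (Fin q) ℝ |
        (({1} : Set (Matrix (Fin p) (Fin p) ℝ)) ∩ F).Nonempty} := MeasurableSet.const _
    have e : {X : Fin n → Matrix (Fin p) (Fin q) ℝ | (candidates N n X ∩ F).Nonempty}
        = ({X | (leftCov X).det ≠ 0 ∧ (rightCov X).det ≠ 0} ∩
            {X | (diagonalizers (leftCov X)⁻¹ (fobiMat N X) ∩ F).Nonempty}) ∪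
          ({X | (leftCov X).det ≠ 0 ∧ (rightCov X).det ≠ 0}ᶜ ∩
            {X | (({1} : Set (Matrix (Fin p) (Fin p) ℝ)) ∩ F).Nonempty}) := by
      ext X
      by_cases hX : (leftCov X).det ≠ 0 ∧ (rightCov X).det ≠ 0
      · simp [candidates, hX]
      · have hc : candidates N n X = {1} := if_neg hX
        change (candidates N n X ∩ F).Nonempty ↔ (_ ∧ _) ∨ (¬ _ ∧ _)
        rw [hc]
        exact ⟨fun h => Or.inr ⟨hX, h⟩, fun h => h.elim (fun h => absurd h.1 hX) fun h => h.2⟩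
    rw [e]
    exact (hdom.inter hhit).union (hdom.compl.inter hone)

/-- Minimizing the distance to the identity before the entries yields consistency and measurability
from one selection. -/
theorem exists_estimator (N : Fin 2) :
    ∃ g : ∀ n : ℕ, (Fin n → Matrix (Fin p) (Fin q) ℝ) → Matrix (Fin p) (Fin p) ℝ,
      IsLeftEstimator N g ∧ ∀ n X, g n X ∈ minimizers (candidates N n) distOne X := by
  have h := fun n => (isSelectable_candidates (p := p) (q := q) N n).exists_measurable
    continuous_distOne (ψ := fun (u : Fin p × Fin p) A => A u.1 u.2)
    fun u => continuous_entry u.1 u.2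
  choose g hg hm using h
  refine ⟨g, fun n => ⟨measurable_of_entries fun a b => hm n (a, b), fun X hl hr => ?_⟩, hg⟩
  rw [isLeftEstimate_iff hl hr]
  have := (hg n X).1
  rwa [candidates, if_pos ⟨hl.det_pos.ne', hr.det_pos.ne'⟩] at this

end Estimators

/-! ### Consistency, asymptotic normality and comparison of the variances -/

section Asymptotics

variable {p q : ℕ} {Ω : Type*} [MeasurableSpace Ω] {P : Measure Ω}
  {Z : ℕ → Ω → Matrix (Fin p) (Fin q) ℝ}

theorem fobiEig_injective (h : IsSample P Z) (N : Fin 2) :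
    Function.Injective (fobiEig N P Z) := fun _ _ hk =>
  h.rowKurt_injective (add_right_cancel hk)

variable [IsProbabilityMeasure P]

namespace IsSample

theorem tendsto_leftCov (h : IsSample P Z) (hq : 0 < q) :
    Tendsto (fun x => leftCov (sampleData Z x)) (whp P) (𝓝 1) :=
  tendsto_matrix_iff.2 fun a b => (h.asympLin_leftCov hq a b).tendsto_center h.isIID

theorem tendsto_rightCov (h : IsSample P Z) (hp : 0 < p) :
    Tendsto (fun x => rightCov (sampleData Z x)) (whp P) (𝓝 1) :=
  tendsto_matrix_iff.2 fun a b => (h.asympLin_rightCov hp a b).tendsto_center h.isIID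

theorem tendsto_fobiMat (h : IsSample P Z) (hp : 0 < p) (hq : 0 < q) (N : Fin 2) :
    Tendsto (fun x => fobiMat N (sampleData Z x)) (whp P)
      (𝓝 (Matrix.diagonal (fobiEig N P Z))) := by
  refine tendsto_matrix_iff.2 fun a b => ?_
  by_cases hab : a = b
  · subst hab
    rw [Matrix.diagonal_apply_eq, ← h.sum_fobiMom_diag hq]
    exact (h.asympLin_fobiMat hp hq N a a).tendsto_center h.isIID
  · rw [Matrix.diagonal_apply_ne _ hab]
    exact (h.asympLin_fobiMat_offDiag hp hq N hab).tendsto_center h.isIID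

theorem eventually_det (h : IsSample P Z) (hp : 0 < p) (hq : 0 < q) :
    ∀ᶠ x in whp P, (leftCov (sampleData Z x)).det ≠ 0 ∧ (rightCov (sampleData Z x)).det ≠ 0 :=
  (eventually_det_ne_zero (h.tendsto_leftCov hq)).and
    (eventually_det_ne_zero (h.tendsto_rightCov hp))

/-- The selected estimate is at least as close to the identity as any other diagonalizer, and with
probability tending to one some diagonalizer is arbitrarily close. -/
theorem exists_consistent (h : IsSample P Z) (hp : 0 < p) (hq : 0 < q) (N : Fin 2) :
    ∃ g, IsLeftEstimator N g ∧ IsConsistent P Z g := by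
  obtain ⟨g, hg, hmin⟩ := exists_estimator (p := p) (q := q) N
  refine ⟨g, hg, fun a b => tendstoInMeasure_iff_whp.2 ?_⟩
  rw [Metric.tendsto_nhds]
  intro ε hε
  have hθ : Tendsto (fun x => ((leftCov (sampleData Z x))⁻¹, fobiMat N (sampleData Z x))) (whp P)
      (𝓝 ((1 : Matrix (Fin p) (Fin p) ℝ), Matrix.diagonal (fobiEig N P Z))) :=
    (tendsto_inv_one (h.tendsto_leftCov hq)).prodMk_nhds (h.tendsto_fobiMat hp hq N)
  filter_upwards [hθ.eventually (eventually_exists_diagonalizer (fobiEig_injective h N)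
    (pow_pos hε 2)), h.eventually_det hp hq] with x hx hdet
  obtain ⟨hmem, hle⟩ := hmin x.1 (sampleData Z x)
  rw [candidates, if_pos hdet] at hmem hle
  obtain ⟨Γ, hΓ, hlt⟩ := hx ⟨_, hmem⟩
  have h1 := (sq_le_distOne (g x.1 (sampleData Z x)) a b).trans_lt ((hle Γ hΓ).trans_lt hlt)
  rw [Real.dist_eq]
  exact abs_lt_of_sq_lt_sq h1 hε.le

theorem asympLin_score (h : IsSample P Z) (hp : 0 < p) (hq : 0 < q) (N : Fin 2) {k k' : Fin p}
    (hk : k ≠ k') :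
    AsympLin P Z (fun x => fobiEig N P Z k * leftCov (sampleData Z x) k k'
      - fobiMat N (sampleData Z x) k k') 0 (score N P Z k k') := by
  refine (((h.asympLin_leftCov hq k k').const_mul (fobiEig N P Z k)).sub
    (h.asympLin_fobiMat_offDiag hp hq N hk)).congr_influence ?_ fun z => rfl
  rw [Matrix.one_apply_ne hk]
  ring

/-- An off-diagonal entry of a consistent MFOBI estimate is asymptotically linear. -/
theorem tendsto_estimate_sub_normSum (h : IsSample P Z) (hp : 0 < p) (hq : 0 < q) (N : Fin 2)
    {k k' : Fin p} (hk : k ≠ k') {G : ℕ × Ω → Matrix (Fin p) (Fin p) ℝ}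
    (hG : Tendsto G (whp P) (𝓝 1))
    (hmem : ∀ᶠ x in whp P, G x ∈ diagonalizers (leftCov (sampleData Z x))⁻¹
      (fobiMat N (sampleData Z x))) :
    Tendsto (fun x => √(x.1 : ℝ) * G x k k' - normSum Z
      (fun z => (fobiEig N P Z k' - fobiEig N P Z k)⁻¹ * score N P Z k k' z) x) (whp P) (𝓝 0) := by
  let S := fun x => leftCov (sampleData Z x)
  let C := fun x => fobiMat N (sampleData Z x)
  let d := fun x => (G x * C x * (G x)ᵀ) k k
  have hS : Tendsto S (whp P) (𝓝 1) := h.tendsto_leftCov hq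
  have hC : Tendsto C (whp P) (𝓝 (Matrix.diagonal (fobiEig N P Z))) := h.tendsto_fobiMat hp hq N
  have hd : Tendsto d (whp P) (𝓝 (fobiEig N P Z k)) := by
    have hc : Continuous fun y : Matrix (Fin p) (Fin p) ℝ × Matrix (Fin p) (Fin p) ℝ =>
        (y.1 * y.2 * y.1ᵀ) k k :=
      (continuous_entry k k).comp ((continuous_fst.matrix_mul continuous_snd).matrix_mul
        continuous_fst.matrix_transpose)
    simpa [Function.comp_def] using (hc.tendsto (1, Matrix.diagonal (fobiEig N P Z))).comp
      (hG.prodMk_nhds hC)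
  have hd0 : Tendsto (fun x => d x - fobiEig N P Z k) (whp P) (𝓝 0) := by
    simpa using hd.sub_const (fobiEig N P Z k)
  let den := fun x => C x k' k' - d x * S x k' k'
  have hden : Tendsto den (whp P) (𝓝 (fobiEig N P Z k' - fobiEig N P Z k)) := by
    simpa using (tendsto_matrix_iff.1 hC k' k').sub (hd.mul (tendsto_matrix_iff.1 hS k' k'))
  have hne : fobiEig N P Z k' - fobiEig N P Z k ≠ 0 :=
    sub_ne_zero.2 fun he => hk (fobiEig_injective h N he).symm
  -- Off-diagonal entries of S and C are centered at 0, so they are bounded in probability even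
  -- after multiplication by √n.
  have hSb : ∀ m, m ≠ k' → BddInProb P (fun x => √(x.1 : ℝ) * S x m k') := by
    intro m hm
    have := (h.asympLin_leftCov hq m k').bddInProb h.isIID
    simpa only [Matrix.one_apply_ne hm, sub_zero] using this
  have hCb : ∀ m, m ≠ k' → BddInProb P (fun x => √(x.1 : ℝ) * C x m k') := by
    intro m hm
    have := (h.asympLin_fobiMat_offDiag hp hq N hm).bddInProb h.isIID
    simpa only [sub_zero] using this
  let B := fun (m : Fin p) x => √(x.1 : ℝ) * C x m k' - d x * (√(x.1 : ℝ) * S x m k')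
  have hB : ∀ m, m ≠ k' → BddInProb P (B m) := by
    intro m hm
    refine ((hCb m hm).add (((hSb m hm).mul_tendsto hd).const_mul (-1))).congr
      (Eventually.of_forall fun x => ?_)
    simp only [B]
    ring
  let num := fun x => -∑ m ∈ Finset.univ.erase k', G x k m * B m x
  have hnum : Tendsto (fun x => num x - normSum Z (score N P Z k k') x) (whp P) (𝓝 0) := by
    have h1 := (h.asympLin_score hp hq N hk).tendsto
    -- Consistency of d without a rate suffices here, because d multiplies an entry of S that is
    -- already of order 1/√n.
    have h2 := (hSb k hk).tendsto_mul hd0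
    have hG0 : ∀ m, Tendsto (fun x => G x k m - (1 : Matrix (Fin p) (Fin p) ℝ) k m) (whp P)
        (𝓝 0) := fun m => by
      have := (tendsto_matrix_iff.1 hG k m).sub_const ((1 : Matrix (Fin p) (Fin p) ℝ) k m)
      simpa only [sub_self] using this
    -- As G tends to the identity, only the summand m = k matters in the limit.
    have h3 : Tendsto (fun x => ∑ m ∈ Finset.univ.erase k',
        (G x k m - (1 : Matrix (Fin p) (Fin p) ℝ) k m) * B m x) (whp P) (𝓝 0) := by
      have := tendsto_finsetSum (Finset.univ.erase k') (f := fun m x =>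
        (G x k m - (1 : Matrix (Fin p) (Fin p) ℝ) k m) * B m x)
        (fun m hm => (hB m (Finset.ne_of_mem_erase hm)).tendsto_mul (hG0 m))
      simpa using this
    have h4 := (h1.add h2).sub h3
    simp only [add_zero, sub_zero] at h4
    refine h4.congr fun x => ?_
    have e1 : ∑ m ∈ Finset.univ.erase k', (1 : Matrix (Fin p) (Fin p) ℝ) k m * B m x = B k x := by
      rw [Finset.sum_eq_single k]
      · simp
      · intro m _ hm
        rw [Matrix.one_apply_ne (Ne.symm hm), zero_mul]
      · simp [hk]
    simp only [num, sub_mul, Finset.sum_sub_distrib, e1]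
    simp only [B]
    ring
  have hnumb : BddInProb P num := by
    have hs := h.asympLin_score hp hq N hk
    refine ((BddInProb.of_tendsto hnum).add (h.isIID.bddInProb_normSum hs.measurable hs.memLp
      hs.mean)).congr (Eventually.of_forall fun x => ?_)
    ring
  have hinv : Tendsto (fun x => (den x)⁻¹ - (fobiEig N P Z k' - fobiEig N P Z k)⁻¹) (whp P)
      (𝓝 0) := by
    simpa using (hden.inv₀ hne).sub_const (fobiEig N P Z k' - fobiEig N P Z k)⁻¹
  have hfin := (hnumb.tendsto_mul hinv).add
    (hnum.const_mul (fobiEig N P Z k' - fobiEig N P Z k)⁻¹)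
  rw [mul_zero, add_zero] at hfin
  refine hfin.congr' ?_
  filter_upwards [hmem, eventually_det_ne_zero hS, hden.eventually_ne hne] with x hx hdet hdx
  -- The eigenvector equation in column k' is solved for G_kk'; its coefficient `den` tends to the
  -- nonzero eigenvalue gap.
  have h5 := sum_diagonalizer_eq_zero hdet hx k k'
  rw [← Finset.add_sum_erase _ _ (Finset.mem_univ k')] at h5
  have h6 : √(x.1 : ℝ) * G x k k' * den x = num x := by
    have e1 : ∑ m ∈ Finset.univ.erase k', G x k m * B m x = √(x.1 : ℝ) *
        ∑ m ∈ Finset.univ.erase k', G x k m * (C x m k' - d x * S x m k') := by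
      rw [Finset.mul_sum]
      refine Finset.sum_congr rfl fun m _ => ?_
      simp only [B]
      ring
    simp only [num, e1]
    linear_combination √(x.1 : ℝ) * h5
  have h7 : √(x.1 : ℝ) * G x k k' = (den x)⁻¹ * num x := by
    rw [← h6]
    field_simp
  have h8 : normSum Z (fun z => (fobiEig N P Z k' - fobiEig N P Z k)⁻¹ * score N P Z k k' z) x
      = (fobiEig N P Z k' - fobiEig N P Z k)⁻¹ * normSum Z (score N P Z k k') x := by
    simp only [normSum, ← Finset.mul_sum]
    ring
  rw [h7, h8]
  ring

theorem isAsymptoticVariance (h : IsSample P Z) (hq : 0 < q) (N : Fin 2) {k k' : Fin p}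
    (hk : k ≠ k') :
    IsAsymptoticVariance P Z N k k' (∫ ω, ((fobiEig N P Z k' - fobiEig N P Z k)⁻¹ *
      score N P Z k k' (Z 0 ω)) ^ 2 ∂P).toNNReal := by
  have hp : 0 < p := k.pos
  refine ⟨h.exists_consistent hp hq N, fun g hg hcons => ?_⟩
  have hs := (h.asympLin_score hp hq N hk).const_mul (fobiEig N P Z k' - fobiEig N P Z k)⁻¹
  refine AsympLin.tendstoInDistribution h.isIID hs.measurable hs.memLp hs.mean ?_ ?_
  · intro n
    have hZ : Measurable fun ω => fun i : Fin n => Z i ω :=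
      measurable_pi_lambda _ fun i => h.measurable i
    have h1 : Measurable fun ω => estimate g Z n ω := (hg n).1.comp hZ
    exact (((measurable_entry h1 k k').sub_const _).const_mul _).aemeasurable
  · have hG : Tendsto (fun x : ℕ × Ω => estimate g Z x.1 x.2) (whp P) (𝓝 1) :=
      tendsto_matrix_iff.2 fun a b => tendstoInMeasure_iff_whp
        (f := fun n ω => estimate g Z n ω a b) |>.1 (hcons a b)
    have hmem : ∀ᶠ x : ℕ × Ω in whp P, estimate g Z x.1 x.2 ∈
        diagonalizers (leftCov (sampleData Z x))⁻¹ (fobiMat N (sampleData Z x)) := by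
      filter_upwards [h.eventually_det hp hq] with x hx
      exact ((hg x.1).2 (sampleData Z x) ((leftCov_posSemidef _).posDef_iff_det_ne_zero.2 hx.1)
        ((rightCov_posSemidef _).posDef_iff_det_ne_zero.2 hx.2)).mem_diagonalizers
    simpa only [Matrix.one_apply_ne hk, sub_zero] using
      h.tendsto_estimate_sub_normSum hp hq N hk hG hmem

theorem score_sq_lt_iff (h : IsSample P Z) (hq : 1 < q) (hp : 2 < p) {k k' : Fin p}
    (hk : k ≠ k') :
    ∫ ω, score 1 P Z k k' (Z 0 ω) ^ 2 ∂P < ∫ ω, score 0 P Z k k' (Z 0 ω) ^ 2 ∂P ↔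
      ((p : ℝ) - 2)⁻¹ * ∑ m with m ≠ k ∧ m ≠ k', rowKurt P (Z 0) m < 2 := by
  have hq0 : 0 < q := by omega
  have hq1 : (1 : ℝ) < q := by exact_mod_cast hq
  have hp2 : (0 : ℝ) < p - 2 := by
    have : (2 : ℝ) < p := by exact_mod_cast hp
    linarith
  rw [h.integral_score_sq 1 hk, h.integral_score_sq 0 hk]
  simp only [h.sum_integral_rowNoise_zero hq0, h.sum_integral_rowNoise_one hq0,
    Finset.sum_add_distrib, Finset.sum_sub_distrib, ← Finset.mul_sum, Finset.sum_const,
    nsmul_eq_mul, card_other_rows hk]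
  obtain ⟨s, hs⟩ : ∃ s, s = ∑ m with m ≠ k ∧ m ≠ k', rowKurt P (Z 0) m := ⟨_, rfl⟩
  rw [← hs, inv_mul_lt_iff₀ hp2, add_lt_add_iff_left, mul_lt_mul_iff_right₀ (by positivity)]
  have hpos : 0 < (q : ℝ) * (q - 1) := mul_pos (by linarith) (by linarith)
  rw [← sub_pos, ← sub_pos (a := ((p : ℝ) - 2) * 2)]
  -- The left side is q² times the difference of the two score variances; q > 1 makes the factor q(q
  -- − 1) positive.
  have e : s * q + (p - 2) * (q : ℝ) ^ 2 - (p - 2) * (2 * q) - q * (q * s - (p - 2) * q)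
      = (q : ℝ) * (q - 1) * ((p - 2) * 2 - s) := by ring
  rw [← mul_pos_iff_of_pos_left hpos (b := ((p : ℝ) - 2) * 2 - s), ← e]
  ring_nf

theorem score_eq_of_two (h : IsSample P Z) (hp : p = 2) {k k' : Fin p} (hk : k ≠ k') :
    ∫ ω, score 1 P Z k k' (Z 0 ω) ^ 2 ∂P = ∫ ω, score 0 P Z k k' (Z 0 ω) ^ 2 ∂P := by
  have hcard := card_other_rows hk
  have : (Finset.univ.filter fun m : Fin p => m ≠ k ∧ m ≠ k') = ∅ := by
    rw [← Finset.card_eq_zero]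
    have hp' : (p : ℝ) = 2 := by exact_mod_cast hp
    rw [hp', sub_self] at hcard
    exact_mod_cast hcard
  rw [h.integral_score_sq 1 hk, h.integral_score_sq 0 hk, this]
  simp

end IsSample

end Asymptotics

end MFOBI

theorem mainTheorem9 (p q : ℕ) (hq : 1 < q) :
    (∀ {Ω : Type*} [MeasurableSpace Ω] (P : Measure Ω) [IsProbabilityMeasure P]
        (Z : ℕ → Ω → Matrix (Fin p) (Fin q) ℝ), MFOBI.IsSample P Z →
        ∀ k k' : Fin p, k ≠ k' →
          ∃ v₀ v₁ : ℝ≥0,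
            MFOBI.IsAsymptoticVariance P Z 0 k k' v₀ ∧
            MFOBI.IsAsymptoticVariance P Z 1 k k' v₁ ∧
            (2 < p → (v₁ < v₀ ↔
              ((p : ℝ) - 2)⁻¹ * ∑ m with m ≠ k ∧ m ≠ k', MFOBI.rowKurt P (Z 0) m < 2)) ∧
            (p = 2 → v₁ = v₀)) ∧
    (p = 2 → ∀ (n : ℕ) (X : Fin n → Matrix (Fin p) (Fin q) ℝ),
        (∀ v : Fin p → ℝ, MFOBI.IsEigenvector (MFOBI.leftFobi 0 X) v ↔
          MFOBI.IsEigenvector (MFOBI.leftFobi 1 X) v) ∧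
        (∀ (L : Matrix (Fin p) (Fin p) ℝ) (R : Matrix (Fin q) (Fin q) ℝ) (v : Fin p → ℝ),
          MFOBI.IsInvSqrt (MFOBI.leftCov X) L → MFOBI.IsInvSqrt (MFOBI.rightCov X) R →
          (MFOBI.IsEigenvector (MFOBI.leftFobi 0 (MFOBI.standardized L R X)) v ↔
            MFOBI.IsEigenvector (MFOBI.leftFobi 1 (MFOBI.standardized L R X)) v)) ∧
        (∀ Γ : Matrix (Fin p) (Fin p) ℝ,
          MFOBI.IsLeftEstimate 0 X Γ ↔ MFOBI.IsLeftEstimate 1 X Γ)) := by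
  refine ⟨fun {Ω} _ P _ Z h k k' hk => ?_, ?_⟩
  · have hq0 : 0 < q := by omega
    refine ⟨_, _, h.isAsymptoticVariance hq0 0 hk, h.isAsymptoticVariance hq0 1 hk, ?_, ?_⟩
    · intro hp
      -- The eigenvalue gap is the same for both choices, so comparing asymptotic variances amounts
      -- to comparing second moments of the scores.
      have e : ∀ N, MFOBI.fobiEig N P Z k' - MFOBI.fobiEig N P Z k
          = MFOBI.rowKurt P (Z 0) k' - MFOBI.rowKurt P (Z 0) k := fun N => by
        simp [MFOBI.fobiEig]
      have hne : MFOBI.rowKurt P (Z 0) k' - MFOBI.rowKurt P (Z 0) k ≠ 0 :=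
        sub_ne_zero.2 fun he => hk (h.rowKurt_injective he).symm
      rw [← h.score_sq_lt_iff hq hp hk, Real.toNNReal_lt_toNNReal_iff_of_nonneg
        (integral_nonneg fun ω => sq_nonneg _)]
      simp only [e, mul_pow, integral_const_mul]
      exact mul_lt_mul_iff_right₀ (by positivity)
    · intro hp
      congr 1
      simp only [mul_pow, integral_const_mul, h.score_eq_of_two hp hk]
      simp [MFOBI.fobiEig]
  · rintro rfl n X
    exact ⟨fun v => MFOBI.isEigenvector_leftFobi_fin_two X v,
      fun L R v _ _ => MFOBI.isEigenvector_leftFobi_fin_two _ v,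
      fun Γ => MFOBI.isLeftEstimate_fin_two X Γ⟩
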